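/- Let $n\ge 2$, $0\le s\le n+1$, and let $\mathbb{E}^{n+1}_s$ be $\mathbb{R}^{n+1}$ with the flat metric $\tilde g=-dx_1^2-\cdots-dx_s^2+dx_{s+1}^2+\cdots+dx_{n+1}^2$. Let $M$ be a connected smooth $n$-manifold (Hausdorff, second countable, without boundary), smoothly immersed by $\psi:M\to\mathbb{E}^{n+1}_s$ as a pseudo-Riemannian hypersurface, i.e. such that the induced metric $g=\psi^*\tilde g$ is non-degenerate at every point. Let $V^T$ be the tangential part of the position vector field, i.e. the vector field on $M$ with $\tilde g(\psi(p)-d\psi_p(V^T_p),d\psi_p(w))=0$ for all $p\in M$ and $w\in T_pM$. Suppose that $(M,g,V^T,\varphi)$ is a conformal soliton, meaning that $\varphi:M\to\mathbb{R}$ is smooth and $$\varphi g=\tfrac12\mathcal{L}_{V^T}g ,$$ where $(\mathcal{L}_Xg)(Y,Z)=X(g(Y,Z))-g([X,Y],Z)-g(Y,[X,Z])$; completeness of $V^T$ is not required. Then $\psi(M)$ is contained in one of the following: 1. an affine hyperplane of $\mathbb{R}^{n+1}$; 2. a conic hypersurface with vertex at the origin, i.e. a set $\{t\gamma(y): t\ge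 0,\ y\in L\}$, where $L$ is a smooth (Hausdorff, second countable, not necessarily connected) $(n-1)$-manifold and $\gamma:L\to\mathbb{R}^{n+1}$ is a smooth map for which $(t,y)\mapsto t\gamma(y)$ is an immersion of $(0,\infty)\times L$; 3. a pseudo-hyperbolic space $\{x:\tilde g(x-a,x-a)=-r^2\}$ with some centre $a\in\mathbb{R}^{n+1}$ and some $r>0$; 4. a pseudo-sphere $\{x:\tilde g(x-a,x-a)=r^2\}$ with some centre $a\in\mathbb{R}^{n+1}$ and some $r>0$. -/

import Mathlib

open scoped Manifold ContDiff

noncomputable section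

namespace ConformalSoliton

/-- The underlying space `ℝ ^ m` of the pseudo-Euclidean spaces of dimension `m`; its Euclidean
structure only provides the topology and the smooth structure. -/
abbrev E (m : ℕ) : Type := EuclideanSpace ℝ (Fin m)

/-- The flat metric `- x₁ y₁ - ⋯ - x_s y_s + x_{s+1} y_{s+1} + ⋯ + x_m y_m` of the pseudo-Euclidean
space of dimension `m` and index `s`. -/
def flatMetric (m s : ℕ) : LinearMap.BilinForm ℝ (E m) :=
  LinearMap.mk₂ ℝ (fun x y => ∑ i : Fin m, (if (i : ℕ) < s then (-1 : ℝ) else 1) * (x i * y i))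
    (fun x x' y => by
      rw [← Finset.sum_add_distrib]
      exact Finset.sum_congr rfl fun i _ => by rw [PiLp.add_apply]; ring)
    (fun c x y => by
      rw [smul_eq_mul, Finset.mul_sum]
      exact Finset.sum_congr rfl fun i _ => by rw [PiLp.smul_apply, smul_eq_mul]; ring)
    (fun x y y' => by
      rw [← Finset.sum_add_distrib]
      exact Finset.sum_congr rfl fun i _ => by rw [PiLp.add_apply]; ring)
    (fun c x y => by
      rw [smul_eq_mul, Finset.mul_sum]
      exact Finset.sum_congr rfl fun i _ => by rw [PiLp.smul_apply, smul_eq_mul]; ring)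

section Manifold

variable {n : ℕ} {M : Type*} [TopologicalSpace M] [ChartedSpace (E n) M]

/-- The vector field `X` on `M` is smooth, as a section of the tangent bundle. -/
def IsSmoothVectorField [IsManifold (𝓡 n) ∞ M] (X : ∀ p : M, TangentSpace (𝓡 n) p) : Prop :=
  ContMDiff (𝓡 n) (𝓡 n).tangent ∞ (fun p => (⟨p, X p⟩ : TangentBundle (𝓡 n) M))

/-- The derivative `u f` of a function `f` along a tangent vector `u` at `p`. -/
def dirDeriv (f : M → ℝ) (p : M) (u : TangentSpace (𝓡 n) p) : ℝ :=
  mfderiv (𝓡 n) 𝓘(ℝ, ℝ) f p u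

/-- The Lie derivative of a field `g` of bilinear forms along `X`, evaluated on `Y`, `Z`:
`(L_X g)(Y, Z) = X (g(Y, Z)) - g([X, Y], Z) - g(Y, [X, Z])`. -/
def lieDerivative (g : ∀ p : M, LinearMap.BilinForm ℝ (TangentSpace (𝓡 n) p))
    (X Y Z : ∀ p : M, TangentSpace (𝓡 n) p) (p : M) : ℝ :=
  dirDeriv (fun q => g q (Y q) (Z q)) p (X p)
    - g p (VectorField.mlieBracket (𝓡 n) X Y p) (Z p)
    - g p (Y p) (VectorField.mlieBracket (𝓡 n) X Z p)

/-- `(M, g, v, φ)` is a conformal soliton: `φ g = (1 / 2) L_v g`, with `v` and `φ` smooth.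
Completeness of `v` is not required. -/
structure IsConformalSoliton [IsManifold (𝓡 n) ∞ M]
    (g : ∀ p : M, LinearMap.BilinForm ℝ (TangentSpace (𝓡 n) p))
    (v : ∀ p : M, TangentSpace (𝓡 n) p) (φ : M → ℝ) : Prop where
  smooth_field : IsSmoothVectorField v
  smooth_fun : ContMDiff (𝓡 n) 𝓘(ℝ, ℝ) ∞ φ
  eq : ∀ Y Z : (∀ p : M, TangentSpace (𝓡 n) p), IsSmoothVectorField Y → IsSmoothVectorField Z →
    ∀ p : M, φ p * g p (Y p) (Z p) = (1 / 2) * lieDerivative g v Y Z p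

/-- The differential of `ψ : M → ℝ ^ m` at `p`, with values in `ℝ ^ m`. -/
def differential (n : ℕ) {M : Type*} [TopologicalSpace M] [ChartedSpace (E n) M] {m : ℕ}
    (ψ : M → E m) (p : M) : TangentSpace (𝓡 n) p →ₗ[ℝ] E m :=
  (mfderiv (𝓡 n) 𝓘(ℝ, E m) ψ p).toLinearMap

/-- The pull-back to `M` of the flat metric of index `s` by `ψ`. -/
def inducedMetric (n : ℕ) {M : Type*} [TopologicalSpace M] [ChartedSpace (E n) M] {m : ℕ} (s : ℕ)
    (ψ : M → E m) (p : M) :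
    LinearMap.BilinForm ℝ (TangentSpace (𝓡 n) p) :=
  (flatMetric m s).comp (differential n ψ p) (differential n ψ p)

/-- `ψ` is a smooth immersion of the `n`-dimensional manifold `M` as a pseudo-Riemannian
hypersurface of the pseudo-Euclidean space of dimension `n + 1` and index `s`: the induced metric
is non-degenerate. -/
structure IsPseudoRiemannianHypersurface (s : ℕ) (ψ : M → E (n + 1)) : Prop where
  smooth : ContMDiff (𝓡 n) 𝓘(ℝ, E (n + 1)) ∞ ψ
  immersion : ∀ p : M, Function.Injective (differential n ψ p)
  nondegenerate : ∀ p : M, (inducedMetric n s ψ p).Nondegenerate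

instance (p : M) : FiniteDimensional ℝ (TangentSpace (𝓡 n) p) :=
  inferInstanceAs (FiniteDimensional ℝ (E n))

/-- The tangential part of the position vector field of a pseudo-Riemannian hypersurface, as a
vector field on `M`: the vector representing the linear form `w ↦ ⟨ψ p, dψ w⟩` with respect to the
induced metric. -/
def tangentialPosition {s : ℕ} {ψ : M → E (n + 1)} (h : IsPseudoRiemannianHypersurface s ψ)
    (p : M) : TangentSpace (𝓡 n) p :=
  ((inducedMetric n s ψ p).toDual (h.nondegenerate p)).symm
    ((flatMetric (n + 1) s (ψ p)).comp (differential n ψ p))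

/-- The position vector minus its tangential part is normal to the hypersurface. -/
theorem flatMetric_sub_tangentialPosition {s : ℕ} {ψ : M → E (n + 1)}
    (h : IsPseudoRiemannianHypersurface s ψ) (p : M) (w : TangentSpace (𝓡 n) p) :
    flatMetric (n + 1) s (ψ p - differential n ψ p (tangentialPosition h p))
      (differential n ψ p w) = 0 := by
  have key : inducedMetric n s ψ p (tangentialPosition h p) w =
      flatMetric (n + 1) s (ψ p) (differential n ψ p w) := by
    simp [tangentialPosition, LinearMap.BilinForm.apply_toDual_symm_apply]
  rw [map_sub, LinearMap.sub_apply, ← key]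
  simp [inducedMetric]

end Manifold

/-- An affine hyperplane of `ℝ ^ m`. -/
def IsHyperplane {m : ℕ} (S : Set (E m)) : Prop :=
  ∃ (l : E m →ₗ[ℝ] ℝ) (b : ℝ), l ≠ 0 ∧ S = {x | l x = b}

/-- A pseudo-sphere `{x | ⟨x - a, x - a⟩ = r ^ 2}` with centre `a` and radius `r > 0`. -/
def IsPseudoSphere {m : ℕ} (s : ℕ) (S : Set (E m)) : Prop :=
  ∃ (a : E m) (r : ℝ), 0 < r ∧ S = {x | flatMetric m s (x - a) (x - a) = r ^ 2}

/-- A pseudo-hyperbolic space `{x | ⟨x - a, x - a⟩ = - r ^ 2}` with centre `a` and `r > 0`. -/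
def IsPseudoHyperbolicSpace {m : ℕ} (s : ℕ) (S : Set (E m)) : Prop :=
  ∃ (a : E m) (r : ℝ), 0 < r ∧ S = {x | flatMetric m s (x - a) (x - a) = - r ^ 2}

/-- A conic hypersurface of `ℝ ^ (n + 1)` with vertex at the origin, possibly with
self-intersections: the union of the rays `{t γ(y) | t ≥ 0}`, where `y` runs through a smooth
(Hausdorff, second countable) manifold `L` of dimension `n - 1` and `γ` is smooth. The condition
`immersion` says that `(t, y) ↦ t γ(y)` is an immersion of the `n`-dimensional manifold
`(0, ∞) × L`; its differential at `(t, y)` is `(a, w) ↦ a γ(y) + t dγ(w)`. -/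
def IsConicHypersurface (n : ℕ) (S : Set (E (n + 1))) : Prop :=
  ∃ (L : Type) (_ : TopologicalSpace L) (_ : T2Space L) (_ : SecondCountableTopology L)
    (_ : ChartedSpace (E (n - 1)) L) (_ : IsManifold (𝓡 (n - 1)) ∞ L) (γ : L → E (n + 1)),
    ContMDiff (𝓡 (n - 1)) 𝓘(ℝ, E (n + 1)) ∞ γ ∧
    (∀ t : ℝ, 0 < t → ∀ (y : L) (a : ℝ) (w : TangentSpace (𝓡 (n - 1)) y),
      a • γ y + t • differential (n - 1) γ y w = 0 → a = 0 ∧ w = 0) ∧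
    S = {x | ∃ t : ℝ, 0 ≤ t ∧ ∃ y : L, x = t • γ y}

end ConformalSoliton

end

open ConformalSoliton

/-! Let `N` be the normal part of the position vector, so `dψ(V^T) = ψ - N`. Expanding the Lie
derivative turns the soliton equation into `⟨dN u, dψ w⟩ = (1 - φ)⟨dψ u, dψ w⟩`
(`mderiv_normalPosition`). For a local unit normal `ξ` of sign `ε` one has `N = ε⟨ψ, ξ⟩ ξ`, hence
`ε⟨ψ, ξ⟩ dξ = (1 - φ) dψ` (`IsSolitonAt.shape_eq`): the hypersurface is umbilical wherever `N ≠ 0`.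

If `N` vanishes identically, the position is everywhere tangent. Away from the origin `ψ` is then
locally a graph satisfying Euler's identity, so it lies in the cone over a slice
(`exists_conic_slice`); countably many slices suffice and form one conic hypersurface
(`isConicHypersurface_of_family`).

If `N ≠ 0` at some point, Codazzi makes the principal curvature constant nearby, so `ψ` lies locally
on a hyperplane off the origin or on a central quadric (`IsSolitonAt.local_classification`). Lying
locally on this fixed hypersurface is an open condition, and connectedness concludes once it is
closed (`IsSolitonAt.eventually_linear_eq_of_frequently`,
`IsSolitonAt.eventually_quadric_of_frequently`). The danger is that `N` vanishes at a limit point.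
On a hyperplane off the origin it cannot. On a quadric it can, but `dξ` is invertible there, so `⟨ψ,
ξ⟩` is nonzero on a dense set and umbilicity extends by continuity. -/

namespace ConformalSoliton

open Filter Topology Set Module

/-! ### Linear algebra of non-degenerate hyperplanes and their normals. -/

section Algebra

variable {V F : Type*} [NormedAddCommGroup V] [NormedSpace ℝ V]
  [NormedAddCommGroup F] [NormedSpace ℝ F]

/-- The pull-back of the bilinear form `B` by `J` is non-degenerate. -/
def NondegenerateAlong (B : F →L[ℝ] F →L[ℝ] ℝ) (J : V →L[ℝ] F) : Prop :=
  ∀ u, (∀ w, B (J u) (J w) = 0) → u = 0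

variable {B : F →L[ℝ] F →L[ℝ] ℝ} {J : V →L[ℝ] F}

lemma NondegenerateAlong.injective (hJ : NondegenerateAlong B J) : Function.Injective J := by
  refine (injective_iff_map_eq_zero J).2 fun u hu => hJ u fun w => ?_
  simp [hu]

/-- Polarisation. The vector obtained serves to express the principal curvature as a smooth
quotient. -/
lemma NondegenerateAlong.exists_not_null [Nontrivial V] (hJ : NondegenerateAlong B J)
    (hsymm : ∀ x y, B x y = B y x) : ∃ u, B (J u) (J u) ≠ 0 := by
  by_contra! h
  obtain ⟨u, hu⟩ := exists_ne (0 : V)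
  refine hu (hJ u fun w => ?_)
  have := h (u + w)
  simp only [map_add, _root_.add_apply, h, hsymm (J w) (J u)] at this
  linarith

/-- The bilinear form `(u, w) ↦ B (J u) (K w)`. -/
noncomputable def pullbackForm (B : F →L[ℝ] F →L[ℝ] ℝ) (J K : V →L[ℝ] F) : V →L[ℝ] V →L[ℝ] ℝ :=
  ((ContinuousLinearMap.compL ℝ V F ℝ).flip K).comp (B.comp J)

@[simp] lemma pullbackForm_apply (B : F →L[ℝ] F →L[ℝ] ℝ) (J K : V →L[ℝ] F) (u w : V) :
    pullbackForm B J K u w = B (J u) (K w) := rfl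

variable [FiniteDimensional ℝ V]

lemma isInvertible_of_separatingLeft {G : V →L[ℝ] V →L[ℝ] ℝ} (hG : ∀ u, (∀ w, G u w = 0) → u = 0) :
    G.IsInvertible := by
  have hinj : Function.Injective G :=
    (injective_iff_map_eq_zero G).2 fun u hu => hG u fun w => by simp [hu]
  have hd : finrank ℝ V = finrank ℝ (V →L[ℝ] ℝ) := by
    rw [← (LinearMap.toContinuousLinearMap (𝕜 := ℝ) (E := V) (F' := ℝ)).finrank_eq]
    exact Subspace.dual_finrank_eq.symm
  let e : V ≃ₗ[ℝ] (V →L[ℝ] ℝ) := LinearEquiv.ofInjectiveOfFinrankEq G.toLinearMap hinj hd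
  exact ⟨e.toContinuousLinearEquiv, by ext; rfl⟩

variable [FiniteDimensional ℝ F]

/-- The image of `J` meets the line of `ν` only in zero, since `ν` is orthogonal to that image and
the pulled-back form is non-degenerate; the dimension count does the rest. -/
lemma NondegenerateAlong.exists_decomposition (hJ : NondegenerateAlong B J)
    (hdim : finrank ℝ F = finrank ℝ V + 1) {ν : F} (h0 : ν ≠ 0) (hν : ∀ u, B ν (J u) = 0) (w : F) :
    ∃ (u : V) (c : ℝ), w = J u + c • ν := by
  let T : V × ℝ →ₗ[ℝ] F := J.toLinearMap.coprod (LinearMap.toSpanSingleton ℝ F ν)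
  have hT : Function.Injective T := by
    refine (injective_iff_map_eq_zero T).2 ?_
    rintro ⟨u, c⟩ h
    have h' : J u + c • ν = 0 := by
      simpa [T] using h
    have hu : u = 0 := hJ u fun w => by
      rw [show J u = -(c • ν) from eq_neg_of_add_eq_zero_left h']
      simp [hν]
    subst hu
    simpa [h0] using h'
  have hs : Function.Surjective T :=
    (LinearMap.injective_iff_surjective_of_finrank_eq_finrank (by simp [hdim])).1 hT
  obtain ⟨⟨u, c⟩, h⟩ := hs w
  exact ⟨u, c, by simpa [T] using h.symm⟩

/-- A null normal would be orthogonal to the image of `J` and to itself, hence to all of `F`. -/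
lemma NondegenerateAlong.normal_not_null (hJ : NondegenerateAlong B J)
    (hdim : finrank ℝ F = finrank ℝ V + 1) (hB : ∀ x, (∀ y, B x y = 0) → x = 0)
    {ν : F} (h0 : ν ≠ 0) (hν : ∀ u, B ν (J u) = 0) : B ν ν ≠ 0 := by
  intro h
  refine h0 (hB ν fun y => ?_)
  obtain ⟨u, c, rfl⟩ := hJ.exists_decomposition hdim h0 hν y
  simp [hν, h]

lemma NondegenerateAlong.eq_smul_of_normal (hJ : NondegenerateAlong B J)
    (hdim : finrank ℝ F = finrank ℝ V + 1)
    {ν w : F} (h1 : B ν ν ≠ 0) (hν : ∀ u, B ν (J u) = 0) (hw : ∀ u, B w (J u) = 0) :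
    w = (B w ν / B ν ν) • ν := by
  have h0 : ν ≠ 0 := by rintro rfl; simp at h1
  obtain ⟨u, c, rfl⟩ := hJ.exists_decomposition hdim h0 hν w
  have hu : u = 0 := hJ u fun z => by simpa [hν] using hw z
  subst hu
  simp [h1]

lemma NondegenerateAlong.eq_zero (hJ : NondegenerateAlong B J)
    (hdim : finrank ℝ F = finrank ℝ V + 1)
    {ν w : F} (h1 : B ν ν ≠ 0) (hν : ∀ u, B ν (J u) = 0) (hw : ∀ u, B w (J u) = 0)
    (hwν : B w ν = 0) : w = 0 := by
  rw [hJ.eq_smul_of_normal hdim h1 hν hw, hwν]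
  simp

end Algebra

/-! ### Unit normals and umbilical immersions in a chart. -/

section LocalAnalysis

lemma eventually_eq_of_hasFDerivAt_zero {V F : Type*} [NormedAddCommGroup V] [NormedSpace ℝ V]
    [NormedAddCommGroup F] [NormedSpace ℝ F] {g : V → F} {x₀ : V}
    (h : ∀ᶠ x in 𝓝 x₀, HasFDerivAt g (0 : V →L[ℝ] F) x) : ∀ᶠ x in 𝓝 x₀, g x = g x₀ := by
  obtain ⟨r, hr, hb⟩ := Metric.eventually_nhds_iff_ball.1 h
  filter_upwards [Metric.ball_mem_nhds x₀ hr] with x hx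
  refine (convex_ball x₀ r).is_const_of_fderivWithin_eq_zero (𝕜 := ℝ)
    (fun y hy => (hb y hy).differentiableAt.differentiableWithinAt) (fun y hy => ?_) hx
    (Metric.mem_ball_self hr)
  rw [fderivWithin_of_isOpen Metric.isOpen_ball hy, (hb y hy).fderiv]

lemma eq_of_frequently_eq {X Y : Type*} [TopologicalSpace X] [TopologicalSpace Y] [T2Space Y]
    {g h : X → Y} {x : X} (hg : ContinuousAt g x) (hh : ContinuousAt h x)
    (hfr : ∃ᶠ y in 𝓝 x, g y = h y) : g x = h x := by
  by_contra hne
  exact hfr ((hg.prodMk hh).eventually (isClosed_diagonal.isOpen_compl.mem_nhds hne))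

variable {V F : Type*} [NormedAddCommGroup V] [NormedSpace ℝ V]
  [NormedAddCommGroup F] [NormedSpace ℝ F] {B : F →L[ℝ] F →L[ℝ] ℝ}
  {f N ξ : V → F} {φ : V → ℝ} {ε : ℝ} {x₀ : V}

lemma contDiffAt_bilin {n : WithTop ℕ∞} {g h : V → F} (hg : ContDiffAt ℝ n g x₀)
    (hh : ContDiffAt ℝ n h x₀) : ContDiffAt ℝ n (fun x => B (g x) (h x)) x₀ :=
  (B.contDiff.contDiffAt.comp x₀ hg).clm_apply hh

lemma hasFDerivAt_bilin {g h : V → F} {g' h' : V →L[ℝ] F} (hg : HasFDerivAt g g' x₀)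
    (hh : HasFDerivAt h h' x₀) (u : V) :
    fderiv ℝ (fun x => B (g x) (h x)) x₀ u = B (g x₀) (h' u) + B (g' u) (h x₀) := by
  have := ((B.hasFDerivAt (x := g x₀)).comp x₀ hg).clm_apply hh
  rw [show (fun x => B (g x) (h x)) = fun x => ((⇑B ∘ g) x) (h x) from rfl, this.fderiv]
  simp

/-- `ξ` is, near `x₀`, a unit normal of the immersion `f`, of sign `ε`. -/
structure IsUnitNormalAt (B : F →L[ℝ] F →L[ℝ] ℝ) (f ξ : V → F) (ε : ℝ) (x₀ : V) : Prop where
  contDiffAt : ContDiffAt ℝ 2 ξ x₀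
  sign : ε = 1 ∨ ε = -1
  unit : ∀ᶠ x in 𝓝 x₀, B (ξ x) (ξ x) = ε
  normal : ∀ᶠ x in 𝓝 x₀, ∀ u, B (ξ x) (fderiv ℝ f x u) = 0

lemma IsUnitNormalAt.sq_sign (h : IsUnitNormalAt B f ξ ε x₀) : ε * ε = 1 := by
  rcases h.sign with h | h <;> simp [h]

lemma IsUnitNormalAt.sign_ne_zero (h : IsUnitNormalAt B f ξ ε x₀) : ε ≠ 0 := by
  rcases h.sign with h | h <;> simp [h]

lemma IsUnitNormalAt.bilin_fderiv_self (h : IsUnitNormalAt B f ξ ε x₀)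
    (hsymm : ∀ x y, B x y = B y x) :
    ∀ᶠ x in 𝓝 x₀, ∀ u, B (fderiv ℝ ξ x u) (ξ x) = 0 := by
  filter_upwards [h.unit.eventually_nhds, h.contDiffAt.eventually (by simp)] with x hx hc u
  have hd := (hc.differentiableAt (by simp)).hasFDerivAt
  have h1 := hasFDerivAt_bilin (B := B) hd hd u
  have h2 : (fun y => B (ξ y) (ξ y)) =ᶠ[𝓝 x] fun _ => ε := hx
  rw [h2.fderiv_eq, hsymm (ξ x)] at h1
  simp only [fderiv_fun_const, Pi.zero_apply, _root_.zero_apply] at h1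
  linarith

/-- The Codazzi equation of an umbilical hypersurface: the principal curvature is constant. -/
lemma eventually_fderiv_eq_zero_of_umbilic (hdimV : 2 ≤ finrank ℝ V) {c : V → ℝ}
    (hf : ContDiffAt ℝ 3 f x₀) (hJ : ∀ᶠ x in 𝓝 x₀, Function.Injective (fderiv ℝ f x))
    (hξ : ContDiffAt ℝ 2 ξ x₀) (hc : ContDiffAt ℝ 1 c x₀)
    (h : ∀ᶠ x in 𝓝 x₀, fderiv ℝ ξ x = c x • fderiv ℝ f x) :
    ∀ᶠ x in 𝓝 x₀, HasFDerivAt c (0 : V →L[ℝ] ℝ) x := by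
  filter_upwards [hf.eventually (by simp), hJ, hξ.eventually (by simp), hc.eventually (by simp),
    h.eventually_nhds] with x hf hJ hξ hc h
  have hdf : ContDiffAt ℝ 2 (fderiv ℝ f) x := hf.fderiv_right (by norm_num)
  have hcd := (hc.differentiableAt (by simp)).hasFDerivAt
  have h2 : fderiv ℝ (fderiv ℝ ξ) x = _ :=
    (EventuallyEq.fderiv_eq h).trans
      (hcd.fun_smul (hdf.differentiableAt (by simp)).hasFDerivAt).fderiv
  have hs1 : IsSymmSndFDerivAt ℝ ξ x := hξ.isSymmSndFDerivAt (by simp)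
  have hs2 : IsSymmSndFDerivAt ℝ f x := (hf.of_le (by norm_num)).isSymmSndFDerivAt (n := 2) (by simp)
  -- Differentiate `dξ = c df`: symmetry of both second derivatives leaves `dc(u) df(w) = dc(w)
  -- df(u)`, and `df` is injective.
  have key : ∀ u w, fderiv ℝ c x u • w = fderiv ℝ c x w • u := by
    intro u w
    refine hJ ?_
    have := hs1 u w
    rw [h2] at this
    simp only [_root_.add_apply, _root_.smul_apply, ContinuousLinearMap.smulRight_apply,
      hs2 u w] at this
    simpa using add_left_cancel this
  suffices fderiv ℝ c x = 0 by rwa [this] at hcd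
  by_contra hne
  obtain ⟨u, hu⟩ : ∃ u, fderiv ℝ c x u ≠ 0 := by
    by_contra! h; exact hne (by ext u; simpa using h u)
  have : finrank ℝ V ≤ 1 := finrank_le_one u fun w =>
    ⟨(fderiv ℝ c x u)⁻¹ * fderiv ℝ c x w, by rw [mul_smul, ← key u w, inv_smul_smul₀ hu]⟩
  omega

lemma contDiffAt_pullbackForm {n : WithTop ℕ∞} {J K : V → V →L[ℝ] F} (hJ : ContDiffAt ℝ n J x₀)
    (hK : ContDiffAt ℝ n K x₀) : ContDiffAt ℝ n (fun x => pullbackForm B (J x) (K x)) x₀ := by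
  refine ContDiffAt.clm_comp ?_ (contDiffAt_const.clm_comp hJ)
  have h : ContDiff ℝ n fun T : V →L[ℝ] F => (ContinuousLinearMap.compL ℝ V F ℝ).flip T := by
    fun_prop
  exact h.contDiffAt.comp x₀ hK

variable [FiniteDimensional ℝ V]

lemma NondegenerateAlong.isInvertible {J : V →L[ℝ] F} (hJ : NondegenerateAlong B J) :
    (pullbackForm B J J).IsInvertible :=
  isInvertible_of_separatingLeft hJ

lemma eventually_isInvertible {X : Type*} [TopologicalSpace X] {x₀ : X}
    {G : X → V →L[ℝ] V →L[ℝ] ℝ} (hG : ContinuousAt G x₀) (h : (G x₀).IsInvertible) :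
    ∀ᶠ x in 𝓝 x₀, (G x).IsInvertible := by
  have := hG.eventually (ContinuousLinearEquiv.isOpen.mem_nhds h)
  exact this

lemma eventually_nondegenerateAlong (hf : ContDiffAt ℝ 3 f x₀)
    (hJ : NondegenerateAlong B (fderiv ℝ f x₀)) :
    ∀ᶠ x in 𝓝 x₀, NondegenerateAlong B (fderiv ℝ f x) := by
  have hd : ContDiffAt ℝ 2 (fderiv ℝ f) x₀ := hf.fderiv_right (by norm_num)
  filter_upwards [eventually_isInvertible (contDiffAt_pullbackForm hd hd).continuousAt
    hJ.isInvertible] with x hx u hu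
  exact (injective_iff_map_eq_zero _).1 hx.injective u (by ext w; exact hu w)

/-- Subtract from the constant vector `ν` its tangential projection, computed with the inverse Gram
form, and normalise; `B ν ν ≠ 0` keeps the result non-null near `x₀`. -/
lemma exists_isUnitNormalAt (hf : ContDiffAt ℝ 3 f x₀)
    (hJ : NondegenerateAlong B (fderiv ℝ f x₀)) {ν : F} (h0 : B ν ν ≠ 0)
    (hν : ∀ u, B ν (fderiv ℝ f x₀ u) = 0) :
    ∃ ξ ε, IsUnitNormalAt B f ξ ε x₀ := by
  have hd : ContDiffAt ℝ 2 (fderiv ℝ f) x₀ := hf.fderiv_right (by norm_num)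
  set G : V → V →L[ℝ] V →L[ℝ] ℝ := fun x => pullbackForm B (fderiv ℝ f x) (fderiv ℝ f x) with hGdef
  have hG : ContDiffAt ℝ 2 G x₀ := contDiffAt_pullbackForm hd hd
  have hGi : (G x₀).IsInvertible := hJ.isInvertible
  set n : V → F := fun x => ν - fderiv ℝ f x ((G x).inverse ((B ν).comp (fderiv ℝ f x))) with hn
  have hnc : ContDiffAt ℝ 2 n x₀ := by
    refine contDiffAt_const.sub (hd.clm_apply (ContDiffAt.clm_apply ?_ ?_))
    · exact ContDiffAt.comp x₀ hGi.contDiffAt_map_inverse hG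
    · exact contDiffAt_const.clm_comp hd
  have hn0 : n x₀ = ν := by
    have : (B ν).comp (fderiv ℝ f x₀) = 0 := by ext u; exact hν u
    simp [hn, this]
  have hnn : ∀ᶠ x in 𝓝 x₀, ∀ u, B (n x) (fderiv ℝ f x u) = 0 := by
    filter_upwards [eventually_isInvertible hG.continuousAt hGi] with x hx u
    have := congrArg (fun T => T u) (hx.self_apply_inverse ((B ν).comp (fderiv ℝ f x)))
    simp only [hGdef, pullbackForm_apply, ContinuousLinearMap.comp_apply] at this
    simp [hn, hGdef, this]
  obtain ⟨ε, hε, hpos⟩ : ∃ ε : ℝ, (ε = 1 ∨ ε = -1) ∧ 0 < ε * B ν ν := by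
    rcases lt_or_gt_of_ne h0 with h | h
    · exact ⟨-1, Or.inr rfl, by linarith⟩
    · exact ⟨1, Or.inl rfl, by linarith⟩
  have hq : ContDiffAt ℝ 2 (fun x => ε * B (n x) (n x)) x₀ :=
    contDiffAt_const.mul (contDiffAt_bilin hnc hnc)
  have hq0 : 0 < ε * B (n x₀) (n x₀) := by rwa [hn0]
  refine ⟨fun x => (√(ε * B (n x) (n x)))⁻¹ • n x, ε, ?_, hε, ?_, ?_⟩
  · exact ((hq.sqrt hq0.ne').inv (Real.sqrt_pos.2 hq0).ne').smul hnc
  · filter_upwards [hq.continuousAt.eventually (lt_mem_nhds hq0)] with x hx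
    have hs := Real.mul_self_sqrt hx.le
    have hs0 := (Real.sqrt_pos.2 hx).ne'
    have hεε : ε * ε = 1 := by rcases hε with h | h <;> simp [h]
    simp only [map_smul, _root_.smul_apply, smul_eq_mul]
    field_simp
    rw [sq, hs]
    linear_combination (-B (n x) (n x)) * hεε
  · filter_upwards [hnn] with x hx u
    simp [hx]

/-- If the shape operator is a multiple of the identity at a dense set of points, then the normal
is constant, or the immersion is a fixed multiple of the normal up to translation. -/
lemma IsUnitNormalAt.umbilic (hsymm : ∀ x y, B x y = B y x)
    (hdimV : 2 ≤ finrank ℝ V) (hf : ContDiffAt ℝ 3 f x₀)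
    (hJ : NondegenerateAlong B (fderiv ℝ f x₀)) (hξ : IsUnitNormalAt B f ξ ε x₀)
    (h : ∀ᶠ x in 𝓝 x₀, ∃ᶠ y in 𝓝 x, ∃ c : ℝ, fderiv ℝ ξ y = c • fderiv ℝ f y) :
    (∀ᶠ x in 𝓝 x₀, ξ x = ξ x₀) ∨ ∃ r : ℝ, r ≠ 0 ∧ ∃ a, ∀ᶠ x in 𝓝 x₀, f x = a + r • ξ x := by
  have : Nontrivial V := Module.nontrivial_of_finrank_pos (R := ℝ) (by omega)
  have hdf : ContDiffAt ℝ 2 (fderiv ℝ f) x₀ := hf.fderiv_right (by norm_num)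
  have hdξ : ContDiffAt ℝ 1 (fderiv ℝ ξ) x₀ := hξ.contDiffAt.fderiv_right (by norm_num)
  obtain ⟨u, hu⟩ := hJ.exists_not_null hsymm
  -- The only possible principal curvature, written with a fixed `u` so that it is `C¹` also where
  -- umbilicity is not yet known.
  set c : V → ℝ := fun x => B (fderiv ℝ ξ x u) (fderiv ℝ f x u) /
    B (fderiv ℝ f x u) (fderiv ℝ f x u) with hcdef
  have hdfu : ContDiffAt ℝ 1 (fun x => fderiv ℝ f x u) x₀ :=
    (hdf.of_le (by norm_num)).clm_apply contDiffAt_const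
  have hden : ContDiffAt ℝ 1 (fun x => B (fderiv ℝ f x u) (fderiv ℝ f x u)) x₀ :=
    contDiffAt_bilin hdfu hdfu
  have hc : ContDiffAt ℝ 1 c x₀ :=
    (contDiffAt_bilin (hdξ.clm_apply contDiffAt_const) hdfu).div hden hu
  have heq : ∀ᶠ x in 𝓝 x₀, fderiv ℝ ξ x = c x • fderiv ℝ f x := by
    filter_upwards [h, hc.eventually (by simp), hdξ.eventually (by simp),
      hdf.eventually (by simp), (hden.continuousAt.eventually_ne hu).eventually_nhds]
      with x hx hc hdξ hdf hden
    refine eq_of_frequently_eq hdξ.continuousAt (hc.continuousAt.smul hdf.continuousAt)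
      ((hx.and_eventually hden).mono fun y hy => ?_)
    obtain ⟨⟨k, hk⟩, hy⟩ := hy
    have : c y = k := by
      simp only [hcdef, hk, _root_.smul_apply, map_smul, smul_eq_mul]
      field_simp
    rw [hk, Pi.smul_apply', this]
  have hinj : ∀ᶠ x in 𝓝 x₀, Function.Injective (fderiv ℝ f x) :=
    (eventually_nondegenerateAlong hf hJ).mono fun x hx => hx.injective
  have hconst := eventually_eq_of_hasFDerivAt_zero
    (eventually_fderiv_eq_zero_of_umbilic hdimV hf hinj hξ.contDiffAt hc heq)
  by_cases h0 : c x₀ = 0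
  · left
    refine eventually_eq_of_hasFDerivAt_zero ?_
    filter_upwards [heq, hconst, hξ.contDiffAt.eventually (by simp)] with x h1 h2 h3
    rw [h2, h0, zero_smul] at h1
    exact h1 ▸ (h3.differentiableAt (by simp)).hasFDerivAt
  · right
    -- The centre is the constant value of `f - c⁻¹ ξ`, whose derivative vanishes.
    refine ⟨(c x₀)⁻¹, inv_ne_zero h0, f x₀ - (c x₀)⁻¹ • ξ x₀, ?_⟩
    have : ∀ᶠ x in 𝓝 x₀, f x - (c x₀)⁻¹ • ξ x = f x₀ - (c x₀)⁻¹ • ξ x₀ := by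
      refine eventually_eq_of_hasFDerivAt_zero (g := fun x => f x - (c x₀)⁻¹ • ξ x) ?_
      filter_upwards [heq, hconst, hξ.contDiffAt.eventually (by simp), hf.eventually (by simp)]
        with x h1 h2 h3 h4
      have := (h4.differentiableAt (by simp)).hasFDerivAt.sub
        ((h3.differentiableAt (by simp)).hasFDerivAt.const_smul (c x₀)⁻¹)
      rw [h1, h2, inv_smul_smul₀ h0, sub_self] at this
      exact this
    filter_upwards [this] with x hx
    rw [← hx, sub_add_cancel]

end LocalAnalysis

/-! ### Local classification of solitons, and closedness of each type. -/

section LocalSoliton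

variable {V F : Type*} [NormedAddCommGroup V] [NormedSpace ℝ V]
  [NormedAddCommGroup F] [NormedSpace ℝ F] {B : F →L[ℝ] F →L[ℝ] ℝ}
  {f N ξ : V → F} {φ : V → ℝ} {ε : ℝ} {x₀ : V}

/-- Near `x₀`, `f` is an immersion with non-degenerate induced metric, `N` is the normal part of
the position vector `f`, and the shape operator of `N` is `1 - φ` times the identity, up to sign. -/
structure IsSolitonAt (B : F →L[ℝ] F →L[ℝ] ℝ) (f N : V → F) (φ : V → ℝ) (x₀ : V) : Prop where
  contDiffAt : ContDiffAt ℝ 3 f x₀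
  nondegenerate : NondegenerateAlong B (fderiv ℝ f x₀)
  normal : ∀ᶠ x in 𝓝 x₀, ∀ u, B (N x) (fderiv ℝ f x u) = 0
  tangential : ∀ᶠ x in 𝓝 x₀, ∃ v, f x = fderiv ℝ f x v + N x
  eq : ∀ᶠ x in 𝓝 x₀, ∀ u w,
    B (fderiv ℝ N x u) (fderiv ℝ f x w) = (1 - φ x) * B (fderiv ℝ f x u) (fderiv ℝ f x w)

lemma eventually_linear_eq_of_normal {l : F →L[ℝ] ℝ} (hf : ContDiffAt ℝ 3 f x₀)
    (h : ∀ᶠ x in 𝓝 x₀, ∀ u, l (fderiv ℝ f x u) = 0) : ∀ᶠ x in 𝓝 x₀, l (f x) = l (f x₀) := by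
  refine eventually_eq_of_hasFDerivAt_zero (g := fun x => l (f x)) ?_
  filter_upwards [h, hf.eventually (by simp)] with x hx hf
  have := l.hasFDerivAt.comp x (hf.differentiableAt (by simp)).hasFDerivAt
  rwa [show l.comp (fderiv ℝ f x) = 0 by ext u; exact hx u] at this

lemma IsUnitNormalAt.bilin_sub_eq {a : F} {r : ℝ} (hξ : IsUnitNormalAt B f ξ ε x₀)
    (h : ∀ᶠ x in 𝓝 x₀, f x = a + r • ξ x) :
    ∀ᶠ x in 𝓝 x₀, B (f x - a) (f x - a) = ε * r ^ 2 := by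
  filter_upwards [h, hξ.unit] with x h1 h2
  rw [h1, add_sub_cancel_left]
  simp only [map_smul, _root_.smul_apply, smul_eq_mul, h2]
  ring

lemma fderiv_eq_zero_of_eventually_eq {x : V} (h : ∀ᶠ y in 𝓝 x, f y = f x) : fderiv ℝ f x = 0 := by
  have : f =ᶠ[𝓝 x] fun _ => f x := h
  rw [this.fderiv_eq, fderiv_const_apply]

lemma eventually_normal_of_quadric {a : F} {κ : ℝ} {x : V} (hsymm : ∀ x y, B x y = B y x)
    (hf : ContDiffAt ℝ 3 f x) (h : ∀ᶠ y in 𝓝 x, B (f y - a) (f y - a) = κ) :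
    ∀ᶠ y in 𝓝 x, ∀ u, B (f y - a) (fderiv ℝ f y u) = 0 := by
  filter_upwards [h.eventually_nhds, hf.eventually (by simp)] with y hy hf u
  have hd := (hf.differentiableAt (by simp)).hasFDerivAt.sub_const a
  have h1 := hasFDerivAt_bilin (B := B) hd hd u
  have h2 : (fun y => B (f y - a) (f y - a)) =ᶠ[𝓝 y] fun _ => κ := hy
  rw [h2.fderiv_eq, hsymm _ (f y - a)] at h1
  simp only [fderiv_fun_const, Pi.zero_apply, _root_.zero_apply] at h1
  linarith

variable [FiniteDimensional ℝ V] [FiniteDimensional ℝ F]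

/-- The normal space is the line of `ξ`; the tangential part of `f` does not contribute to `B f ξ`,
and `ε⁻¹ = ε`. -/
lemma IsSolitonAt.normal_part_eq (hsol : IsSolitonAt B f N φ x₀) (hsymm : ∀ x y, B x y = B y x)
    (hdim : finrank ℝ F = finrank ℝ V + 1) (hξ : IsUnitNormalAt B f ξ ε x₀) :
    ∀ᶠ x in 𝓝 x₀, N x = (ε * B (f x) (ξ x)) • ξ x := by
  filter_upwards [hsol.normal, hsol.tangential, hξ.unit, hξ.normal,
    eventually_nondegenerateAlong hsol.contDiffAt hsol.nondegenerate] with x h1 ⟨v, h2⟩ h3 h4 h5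
  have := h5.eq_smul_of_normal hdim (h3 ▸ hξ.sign_ne_zero) h4 h1
  rw [h3] at this
  rw [h2, map_add, _root_.add_apply, hsymm _ (ξ x), h4, zero_add]
  conv_lhs => rw [this]
  congr 1
  rw [div_eq_iff hξ.sign_ne_zero]
  linear_combination (-B (N x) (ξ x)) * hξ.sq_sign

/-- The shape operator with respect to the unit normal is a multiple of the identity. -/
lemma IsSolitonAt.shape_eq (hsol : IsSolitonAt B f N φ x₀) (hsymm : ∀ x y, B x y = B y x)
    (hdim : finrank ℝ F = finrank ℝ V + 1) (hξ : IsUnitNormalAt B f ξ ε x₀) :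
    ∀ᶠ x in 𝓝 x₀, (ε * B (f x) (ξ x)) • fderiv ℝ ξ x = (1 - φ x) • fderiv ℝ f x := by
  filter_upwards [(hsol.normal_part_eq hsymm hdim hξ).eventually_nhds, hξ.unit, hξ.normal,
    eventually_nondegenerateAlong hsol.contDiffAt hsol.nondegenerate, hsol.eq,
    hξ.bilin_fderiv_self hsymm, hsol.contDiffAt.eventually (by simp),
    hξ.contDiffAt.eventually (by simp)] with x h1 h3 h4 h5 h6 h7 hf hξd
  have hd : ContDiffAt ℝ 1 (fun x => ε * B (f x) (ξ x)) x :=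
    contDiffAt_const.mul (contDiffAt_bilin (hf.of_le (by norm_num)) (hξd.of_le (by norm_num)))
  have hN : fderiv ℝ N x = _ := (EventuallyEq.fderiv_eq h1).trans
    ((hd.differentiableAt (by simp)).hasFDerivAt.fun_smul
      (hξd.differentiableAt (by simp)).hasFDerivAt).fderiv
  ext u
  -- Against tangent vectors this is the soliton equation, the derivative of the coefficient of `ξ`
  -- dropping out; against `ξ` both sides vanish because `dξ` is tangent.
  refine sub_eq_zero.1 (h5.eq_zero hdim (h3 ▸ hξ.sign_ne_zero) h4 (fun w => ?_) ?_)
  · have := h6 u w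
    rw [hN] at this
    simp only [_root_.add_apply, _root_.smul_apply, ContinuousLinearMap.smulRight_apply, map_add,
      map_smul, h4, smul_eq_mul, mul_zero, add_zero] at this
    simp [this]
  · simp [h7, hsymm _ (ξ x), h4]

variable (hsymm : ∀ x y, B x y = B y x) (hB : ∀ x, (∀ y, B x y = 0) → x = 0)
  (hdim : finrank ℝ F = finrank ℝ V + 1) (hdimV : 2 ≤ finrank ℝ V)

include hsymm hdim hdimV in
/-- Umbilicity at a point where the position vector is not tangent. -/
lemma IsSolitonAt.umbilic (hsol : IsSolitonAt B f N φ x₀) (hξ : IsUnitNormalAt B f ξ ε x₀)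
    (h : ∀ᶠ x in 𝓝 x₀, ∃ᶠ y in 𝓝 x, B (f y) (ξ y) ≠ 0) :
    (∀ᶠ x in 𝓝 x₀, ξ x = ξ x₀) ∨ ∃ r : ℝ, r ≠ 0 ∧ ∃ a, ∀ᶠ x in 𝓝 x₀, f x = a + r • ξ x := by
  refine hξ.umbilic hsymm hdimV hsol.contDiffAt hsol.nondegenerate ?_
  filter_upwards [(hsol.shape_eq hsymm hdim hξ).eventually_nhds, h] with x hx hfr
  refine (hfr.and_eventually hx).mono fun y hy => ?_
  have h0 : ε * B (f y) (ξ y) ≠ 0 := mul_ne_zero hξ.sign_ne_zero hy.1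
  exact ⟨(ε * B (f y) (ξ y))⁻¹ * (1 - φ y), by rw [mul_smul, ← hy.2, inv_smul_smul₀ h0]⟩

include hsymm hB hdim in
lemma IsSolitonAt.exists_unit_normal_of_ne_zero (hsol : IsSolitonAt B f N φ x₀) (h0 : N x₀ ≠ 0) :
    ∃ ξ ε, IsUnitNormalAt B f ξ ε x₀ ∧ ∀ᶠ x in 𝓝 x₀, B (f x) (ξ x) ≠ 0 := by
  obtain ⟨ξ, ε, hξ⟩ := exists_isUnitNormalAt hsol.contDiffAt hsol.nondegenerate
    (hsol.nondegenerate.normal_not_null hdim hB h0 hsol.normal.self_of_nhds)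
    hsol.normal.self_of_nhds
  refine ⟨ξ, ε, hξ, ?_⟩
  have hc : ContinuousAt (fun x => B (f x) (ξ x)) x₀ :=
    (contDiffAt_bilin (hsol.contDiffAt.of_le (by norm_num)) hξ.contDiffAt).continuousAt
  refine hc.eventually_ne fun h => h0 ?_
  rw [(hsol.normal_part_eq hsymm hdim hξ).self_of_nhds, h]
  simp

include hsymm hB hdim hdimV in
/-- Where the position vector is not tangent, the hypersurface is locally a piece of a central
quadric or of a hyperplane. -/
lemma IsSolitonAt.local_classification (hsol : IsSolitonAt B f N φ x₀) (h0 : N x₀ ≠ 0) :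
    (∃ a, ∃ κ : ℝ, κ ≠ 0 ∧ ∀ᶠ x in 𝓝 x₀, B (f x - a) (f x - a) = κ) ∨
      ∃ l : F →L[ℝ] ℝ, l ≠ 0 ∧ ∃ b : ℝ, b ≠ 0 ∧ ∀ᶠ x in 𝓝 x₀, l (f x) = b := by
  obtain ⟨ξ, ε, hξ, hρ⟩ := hsol.exists_unit_normal_of_ne_zero hsymm hB hdim h0
  rcases hsol.umbilic hsymm hdim hdimV hξ
    (hρ.eventually_nhds.mono fun x hx => hx.frequently) with h | ⟨r, hr, a, h⟩
  · right
    refine ⟨B (ξ x₀), ?_, B (ξ x₀) (f x₀), ?_, eventually_linear_eq_of_normal hsol.contDiffAt ?_⟩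
    · intro h
      exact hρ.self_of_nhds (by rw [hsymm, h]; rfl)
    · rw [hsymm]; exact hρ.self_of_nhds
    · filter_upwards [h, hξ.normal] with x h1 h2
      rwa [h1] at h2
  · left
    exact ⟨a, ε * r ^ 2, mul_ne_zero hξ.sign_ne_zero (pow_ne_zero 2 hr), hξ.bilin_sub_eq h⟩

include hsymm hB hdim hdimV in
/-- Being locally a piece of a given hyperplane not through the origin is a closed condition. -/
lemma IsSolitonAt.eventually_linear_eq_of_frequently (hsol : IsSolitonAt B f N φ x₀)
    {l : F →L[ℝ] ℝ} {b : ℝ} (hl : l ≠ 0) (hb : b ≠ 0)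
    (h : ∃ᶠ x in 𝓝 x₀, ∀ᶠ y in 𝓝 x, l (f y) = b) : ∀ᶠ x in 𝓝 x₀, l (f x) = b := by
  have hb0 : l (f x₀) = b := by
    refine eq_of_frequently_eq (g := fun x => l (f x)) ?_ continuousAt_const
      (h.mono fun x hx => hx.self_of_nhds)
    exact l.continuous.continuousAt.comp hsol.contDiffAt.continuousAt
  have hdf : ContinuousAt (fderiv ℝ f) x₀ :=
    (hsol.contDiffAt.fderiv_right (m := 2) (by norm_num)).continuousAt
  have hd : ∃ᶠ x in 𝓝 x₀, l.comp (fderiv ℝ f x) = 0 := by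
    refine (h.and_eventually (hsol.contDiffAt.eventually (by simp))).mono fun x ⟨hx, hf⟩ => ?_
    have h1 := l.hasFDerivAt.comp x (hf.differentiableAt (by simp)).hasFDerivAt
    have h2 : (l ∘ f) =ᶠ[𝓝 x] fun _ => b := hx
    rw [← h1.fderiv, h2.fderiv_eq]
    simp
  have hl0 : l.comp (fderiv ℝ f x₀) = 0 :=
    eq_of_frequently_eq (continuousAt_const.clm_comp hdf) continuousAt_const hd
  -- If the position were tangent at `x₀`, then `l (f x₀) = 0`, as `l` kills tangent vectors; but `b
  -- ≠ 0`.
  have hN : N x₀ ≠ 0 := by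
    intro h0
    obtain ⟨v, hv⟩ := hsol.tangential.self_of_nhds
    rw [hv, h0, add_zero] at hb0
    exact hb (hb0.symm.trans (DFunLike.congr_fun hl0 v))
  obtain ⟨ξ, ε, hξ, hρ⟩ := hsol.exists_unit_normal_of_ne_zero hsymm hB hdim hN
  have hξ0 : ξ x₀ ≠ 0 := fun h => hξ.sign_ne_zero (by rw [← hξ.unit.self_of_nhds, h]; simp)
  rcases hsol.umbilic hsymm hdim hdimV hξ
    (hρ.eventually_nhds.mono fun x hx => hx.frequently) with hc | ⟨r, hr, a, hc⟩
  · rw [← hb0]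
    refine eventually_linear_eq_of_normal hsol.contDiffAt ?_
    -- The normal is constant, so the tangent spaces near `x₀` lie in the one at `x₀`, where `l`
    -- vanishes.
    filter_upwards [hc, hξ.normal] with x h1 h2 u
    obtain ⟨v, c, hw⟩ := hsol.nondegenerate.exists_decomposition hdim hξ0 hξ.normal.self_of_nhds
      (fderiv ℝ f x u)
    have h3 := h2 u
    rw [h1, hw, map_add, hξ.normal.self_of_nhds, map_smul, hξ.unit.self_of_nhds, zero_add,
      smul_eq_mul, mul_eq_zero, or_iff_left hξ.sign_ne_zero] at h3
    rw [hw, h3, zero_smul, add_zero]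
    exact DFunLike.congr_fun hl0 v
  -- On a common open set `l` is a fixed nonzero multiple of `B (ξ y)` for every `y`. Hence `ξ`, and
  -- with it `f = a + r ξ`, is locally constant, contradicting immersivity.
  · exfalso
    obtain ⟨x, hx, hf, hc, hn, hu, hnd⟩ := (h.and_eventually
      ((hsol.contDiffAt.eventually (by simp)).and (hc.eventually_nhds.and
        (hξ.normal.eventually_nhds.and (hξ.unit.eventually_nhds.and
          (eventually_nondegenerateAlong hsol.contDiffAt
            hsol.nondegenerate).eventually_nhds))))).exists
    have hmul : ∀ᶠ y in 𝓝 x, ∀ w, l w = ε * (r⁻¹ * (b - l a)) * B (ξ y) w := by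
      filter_upwards [hx.eventually_nhds, hf.eventually (by simp), hc, hn, hu, hnd]
        with y hy hf hc hn hu hnd w
      have hξ0 : ξ y ≠ 0 := fun h => hξ.sign_ne_zero (by rw [← hu, h]; simp)
      obtain ⟨v, c, rfl⟩ := hnd.exists_decomposition hdim hξ0 hn w
      have h1 : fderiv ℝ (fun y => l (f y)) y v = 0 := by
        have : (fun y => l (f y)) =ᶠ[𝓝 y] fun _ => b := hy
        rw [this.fderiv_eq]; simp
      have h2 : l (fderiv ℝ f y v) = 0 := by
        rw [← h1]
        exact (DFunLike.congr_fun
          (l.hasFDerivAt.comp y (hf.differentiableAt (by simp)).hasFDerivAt).fderiv v).symm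
      have h3 : l (ξ y) = r⁻¹ * (b - l a) := by
        rw [← hy.self_of_nhds, hc]
        simp [hr]
      simp only [map_add, map_smul, h2, h3, hn, hu, smul_eq_mul]
      linear_combination (-c * (r⁻¹ * (b - l a))) * hξ.sq_sign
    have hk : ε * (r⁻¹ * (b - l a)) ≠ 0 := by
      intro h0
      refine hl (ContinuousLinearMap.ext fun w => ?_)
      rw [hmul.self_of_nhds w, h0, zero_mul, _root_.zero_apply]
    have hf0 : fderiv ℝ f x = 0 := by
      refine fderiv_eq_zero_of_eventually_eq ?_
      filter_upwards [hmul, hc] with y hy hcy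
      have : ξ y = ξ x := sub_eq_zero.1 <| hB _ fun w => by
        have := (hy w).symm.trans (hmul.self_of_nhds w)
        rw [map_sub, _root_.sub_apply, mul_left_cancel₀ hk this, sub_self]
      rw [hcy, hc.self_of_nhds, this]
    have : Nontrivial V := Module.nontrivial_of_finrank_pos (R := ℝ) (by omega)
    obtain ⟨u, hu0⟩ := exists_ne (0 : V)
    exact hu0 (hnd.self_of_nhds.injective (by simp [hf0]))

include hsymm hdim hdimV in
/-- Being locally a piece of a given central quadric is a closed condition. -/
lemma IsSolitonAt.eventually_quadric_of_frequently (hsol : IsSolitonAt B f N φ x₀)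
    {a : F} {κ : ℝ} (hκ : κ ≠ 0)
    (h : ∃ᶠ x in 𝓝 x₀, ∀ᶠ y in 𝓝 x, B (f y - a) (f y - a) = κ) :
    ∀ᶠ x in 𝓝 x₀, B (f x - a) (f x - a) = κ := by
  have hV : Nontrivial V := Module.nontrivial_of_finrank_pos (R := ℝ) (by omega)
  obtain ⟨u₀, hu₀⟩ := exists_ne (0 : V)
  have hfc := hsol.contDiffAt
  have hfa : ContDiffAt ℝ 2 (fun x => f x - a) x₀ :=
    (hfc.of_le (by norm_num)).sub contDiffAt_const
  have hdf : ContDiffAt ℝ 2 (fderiv ℝ f) x₀ := hfc.fderiv_right (by norm_num)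
  have hnd := eventually_nondegenerateAlong hsol.contDiffAt hsol.nondegenerate
  have hκ0 : B (f x₀ - a) (f x₀ - a) = κ :=
    eq_of_frequently_eq (contDiffAt_bilin hfa hfa).continuousAt continuousAt_const
      (h.mono fun x hx => hx.self_of_nhds)
  have hn : ∃ᶠ x in 𝓝 x₀, ∀ᶠ y in 𝓝 x, ∀ u, B (f y - a) (fderiv ℝ f y u) = 0 :=
    (h.and_eventually (hfc.eventually (by simp))).mono fun x hx =>
      eventually_normal_of_quadric hsymm hx.2 hx.1
  have hn0 : ∀ u, B (f x₀ - a) (fderiv ℝ f x₀ u) = 0 := fun u =>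
    eq_of_frequently_eq (contDiffAt_bilin hfa (hdf.clm_apply contDiffAt_const)).continuousAt
      continuousAt_const (hn.mono fun x hx => hx.self_of_nhds u)
  -- `N` may vanish at `x₀`, so the unit normal is built from `f x₀ - a`, which is not null since `κ
  -- ≠ 0`.
  obtain ⟨ξ, ε, hξ⟩ := exists_isUnitNormalAt hfc hsol.nondegenerate (hκ0 ▸ hκ) hn0
  have hdξ : ContDiffAt ℝ 1 (fderiv ℝ ξ) x₀ := hξ.contDiffAt.fderiv_right (by norm_num)
  set c : V → ℝ := fun x => ε * B (f x - a) (ξ x) with hcdef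
  have hc : ContDiffAt ℝ 2 c x₀ := contDiffAt_const.mul (contDiffAt_bilin hfa hξ.contDiffAt)
  have hsub : ∀ᶠ x in 𝓝 x₀, (∀ u, B (f x - a) (fderiv ℝ f x u) = 0) → f x - a = c x • ξ x := by
    filter_upwards [hnd, hξ.unit, hξ.normal] with x hnd hu hn h
    have := hnd.eq_smul_of_normal hdim (hu ▸ hξ.sign_ne_zero) hn h
    rw [hu] at this
    conv_lhs => rw [this]
    congr 1
    rw [div_eq_iff hξ.sign_ne_zero, hcdef]
    linear_combination (-B (f x - a) (ξ x)) * hξ.sq_sign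
  -- Differentiate `f - a = c ξ` and pair with `ξ`: both `df` and `dξ` are orthogonal to `ξ`, so `dc
  -- = 0`.
  have hdfr : ∃ᶠ x in 𝓝 x₀, fderiv ℝ f x = c x • fderiv ℝ ξ x := by
    refine (hn.and_eventually (hsub.eventually_nhds.and ((hfc.eventually (by simp)).and
      ((hξ.contDiffAt.eventually (by simp)).and ((hc.eventually (by simp)).and
        (hξ.unit.and (hξ.normal.and (hξ.bilin_fderiv_self hsymm)))))))).mono ?_
    rintro x ⟨hx, hsub, hf, hξd, hc, hu, hnx, hself⟩
    have heq : (fun y => f y - a) =ᶠ[𝓝 x] fun y => c y • ξ y := by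
      filter_upwards [hx, hsub] with y h1 h2 using h2 h1
    have h1 := ((hf.differentiableAt (by simp)).hasFDerivAt.sub_const a).fderiv.symm.trans
      (heq.fderiv_eq.trans ((hc.differentiableAt (by simp)).hasFDerivAt.fun_smul
        (hξd.differentiableAt (by simp)).hasFDerivAt).fderiv)
    ext u
    have h2 := DFunLike.congr_fun h1 u
    simp only [_root_.add_apply, _root_.smul_apply, ContinuousLinearMap.smulRight_apply] at h2
    have h3 := congrArg (fun w => B w (ξ x)) h2
    simp only [map_add, _root_.add_apply, map_smul, _root_.smul_apply, hself, hu,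
      hsymm _ (ξ x), hnx, smul_eq_mul, mul_zero, zero_add] at h3
    rw [eq_comm, mul_eq_zero,
      or_iff_left hξ.sign_ne_zero] at h3
    rw [h2, h3]
    simp
  have hd0 : fderiv ℝ f x₀ = c x₀ • fderiv ℝ ξ x₀ :=
    eq_of_frequently_eq hdf.continuousAt (hc.continuousAt.smul hdξ.continuousAt) hdfr
  have hdne : ∀ {x}, NondegenerateAlong B (fderiv ℝ f x) → fderiv ℝ f x ≠ 0 := fun hJ h0 =>
    hu₀ (hJ.injective (by simp [h0]))
  have hξne : fderiv ℝ ξ x₀ ≠ 0 := fun h => hdne hsol.nondegenerate (by rw [hd0, h, smul_zero])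
  have hinv : (pullbackForm B (fderiv ℝ f x₀) (fderiv ℝ ξ x₀)).IsInvertible := by
    refine isInvertible_of_separatingLeft fun v hv => hsol.nondegenerate v fun w => ?_
    rw [show fderiv ℝ f x₀ w = c x₀ • fderiv ℝ ξ x₀ w from DFunLike.congr_fun hd0 w, map_smul,
      ← pullbackForm_apply, hv, smul_zero]
  -- If `B f ξ` vanished on an open set, `f = df(v)` would be tangent there. Differentiating gives
  -- `B (df v) (dξ u) = 0` for all `u`, so `v = 0` by `hinv`, hence `f = 0` on an open set, which no
  -- immersion allows.
  have hdense : ∀ᶠ x in 𝓝 x₀, ∃ᶠ y in 𝓝 x, B (f y) (ξ y) ≠ 0 := by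
    filter_upwards [(eventually_isInvertible (contDiffAt_pullbackForm (hdf.of_le (by norm_num))
      hdξ).continuousAt hinv).eventually_nhds, (hfc.eventually (by simp)).eventually_nhds,
      (hξ.contDiffAt.eventually (by simp)).eventually_nhds, hξ.normal.eventually_nhds,
      hsol.tangential.eventually_nhds, (hsol.normal_part_eq hsymm hdim hξ).eventually_nhds, hnd]
      with x hinv hf hξd hnx ht hN hnd hfr
    have hρ : ∀ᶠ y in 𝓝 x, B (f y) (ξ y) = 0 := hfr.mono fun y hy => not_not.1 hy
    have hz : ∀ᶠ y in 𝓝 x, f y = 0 := by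
      filter_upwards [hρ.eventually_nhds, hinv, hf, hξd, hnx, ht, hN]
        with y hρ hinv hf hξd hnx ⟨v, hv⟩ hN
      rw [hN, hρ.self_of_nhds, mul_zero, zero_smul, add_zero] at hv
      have hv0 : v = 0 := by
        refine hinv.injective (ContinuousLinearMap.ext fun u => ?_)
        have h1 := hasFDerivAt_bilin (B := B) (hf.differentiableAt (by simp)).hasFDerivAt
          (hξd.differentiableAt (by simp)).hasFDerivAt u
        have h2 : (fun y => B (f y) (ξ y)) =ᶠ[𝓝 y] fun _ => 0 := hρ
        rw [h2.fderiv_eq, hsymm _ (ξ y), hnx] at h1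
        simpa [hv] using h1.symm
      simpa [hv0] using hv
    exact hdne hnd (fderiv_eq_zero_of_eventually_eq (by rwa [hz.self_of_nhds]))
  rcases hsol.umbilic hsymm hdim hdimV hξ hdense with hcst | ⟨r, hr, a', h'⟩
  · exact (hξne (fderiv_eq_zero_of_eventually_eq hcst)).elim
  · have h1 : fderiv ℝ f x₀ = r • fderiv ℝ ξ x₀ := by
      have : f =ᶠ[𝓝 x₀] fun x => a' + r • ξ x := h'
      rw [this.fderiv_eq, fderiv_const_add,
        fderiv_fun_const_smul (hξ.contDiffAt.differentiableAt (by simp))]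
    -- The new quadric is the given one: comparing `df` at `x₀` identifies the radii, then `f x₀`
    -- identifies the centres.
    have hcr : c x₀ = r := smul_left_injective ℝ hξne (hd0.symm.trans h1)
    have haa : a = a' := by
      have h2 := hsub.self_of_nhds hn0
      rw [h'.self_of_nhds, hcr, sub_eq_iff_eq_add, add_comm] at h2
      exact (add_left_cancel h2).symm
    subst haa
    have h3 := hξ.bilin_sub_eq h'
    rw [← hκ0, h3.self_of_nhds]
    exact h3

end LocalSoliton

/-! ### Immersions with tangent position vector are locally conical. -/

section Cone

variable {V F : Type*} [NormedAddCommGroup V] [NormedSpace ℝ V]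
  [NormedAddCommGroup F] [NormedSpace ℝ F] {f : V → F} {x₀ : V}

/-- Euler's theorem on homogeneous functions of degree one, on a ball. -/
lemma homogeneous_of_euler {z₀ z : V} {r t : ℝ}
    (hf : ∀ z ∈ Metric.ball z₀ r, DifferentiableAt ℝ f z ∧ fderiv ℝ f z z = f z)
    (hz : z ∈ Metric.ball z₀ r) (ht : 0 < t) (htz : t • z ∈ Metric.ball z₀ r) :
    f (t • z) = t • f z := by
  set T : Set ℝ := Ioi 0 ∩ (fun s : ℝ => s • z) ⁻¹' Metric.ball z₀ r with hT
  have hTo : IsOpen T := isOpen_Ioi.inter (Metric.isOpen_ball.preimage (by fun_prop))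
  have hTc : Convex ℝ T := (convex_Ioi 0).inter
    ((convex_ball z₀ r).linear_preimage (LinearMap.toSpanSingleton ℝ V z))
  -- Euler's identity at `s • z` is exactly the vanishing of this derivative.
  have hd : ∀ s ∈ T, HasDerivAt (fun s : ℝ => s⁻¹ • f (s • z)) 0 s := by
    intro s hs
    have hs0 : s ≠ 0 := (ne_of_gt hs.1)
    obtain ⟨h1, h2⟩ := hf _ hs.2
    have h3 : HasDerivAt (fun s : ℝ => f (s • z)) (fderiv ℝ f (s • z) z) s := by
      have := h1.hasFDerivAt.comp_hasDerivAt s ((hasDerivAt_id s).smul_const z)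
      simpa [Function.comp_def] using this
    have h4 := (hasDerivAt_inv hs0).fun_smul h3
    convert h4 using 1
    rw [← show fderiv ℝ f (s • z) (s • z) = f (s • z) from h2, map_smul, smul_smul, ← add_smul]
    have : s⁻¹ + -(s ^ 2)⁻¹ * s = 0 := by field_simp; ring
    rw [this, zero_smul]
  have h1 : (1 : ℝ) ∈ T := ⟨mem_Ioi.2 one_pos, by simpa using hz⟩
  have := hTo.is_const_of_deriv_eq_zero hTc.isPreconnected
    (fun s hs => (hd s hs).differentiableAt.differentiableWithinAt)
    (fun s hs => (hd s hs).deriv) h1 (show t ∈ T from ⟨ht, htz⟩)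
  simp only [inv_one, one_smul] at this
  rw [this, smul_inv_smul₀ ht.ne']

variable [FiniteDimensional ℝ V] [FiniteDimensional ℝ F]

/-- An immersed hypersurface whose position vector is tangent is locally the graph of a function
which satisfies Euler's identity. -/
lemma exists_euler_graph (hf : ∀ᶠ x in 𝓝 x₀, ContDiffAt ℝ ∞ f x)
    (hinj : Function.Injective (fderiv ℝ f x₀)) (htan : ∀ᶠ x in 𝓝 x₀, ∃ v, f x = fderiv ℝ f x v)
    (h0 : f x₀ ≠ 0) :
    ∃ (z₀ : V) (g : V → F) (P : F →L[ℝ] V) (r : ℝ), z₀ ≠ 0 ∧ 0 < r ∧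
      (∀ z ∈ Metric.ball z₀ r, ContDiffAt ℝ ∞ g z ∧ fderiv ℝ g z z = g z ∧
        ∀ w, P (fderiv ℝ g z w) = w) ∧
      ∃ h : V → V, Tendsto h (𝓝 x₀) (𝓝 z₀) ∧ ∀ᶠ x in 𝓝 x₀, f x = g (h x) := by
  obtain ⟨P', hP'⟩ := (fderiv ℝ f x₀).toLinearMap.exists_leftInverse_of_injective
    (LinearMap.ker_eq_bot.2 hinj)
  set P : F →L[ℝ] V := LinearMap.toContinuousLinearMap P' with hPdef
  have hP : ∀ w, P (fderiv ℝ f x₀ w) = w := fun w => LinearMap.congr_fun hP' w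
  set h : V → V := fun x => P (f x) with hh
  have hfx := hf.self_of_nhds
  have hhc : ContDiffAt ℝ ∞ h x₀ := P.contDiff.contDiffAt.comp x₀ hfx
  have hhd : ∀ {x}, ContDiffAt ℝ ∞ f x → HasFDerivAt h (P.comp (fderiv ℝ f x)) x := fun hx =>
    P.hasFDerivAt.comp _ (hx.differentiableAt (by simp)).hasFDerivAt
  have hhd0 : HasFDerivAt h ((ContinuousLinearEquiv.refl ℝ V : V ≃L[ℝ] V) : V →L[ℝ] V) x₀ := by
    have := hhd hfx
    convert this using 1
    ext w; exact (hP w).symm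
  set e := hhc.toOpenPartialHomeomorph h hhd0 (by simp) with he
  have hes : x₀ ∈ e.source := hhc.mem_toOpenPartialHomeomorph_source hhd0 (by simp)
  have hec : ∀ x, e x = h x := fun x => by
    rw [he, ContDiffAt.toOpenPartialHomeomorph_coe]
  set g : V → F := fun z => f (e.symm z) with hg
  have hiso : ∀ᶠ x in 𝓝 x₀, (P.comp (fderiv ℝ f x)).IsInvertible := by
    have hc : ContinuousAt (fun x => P.comp (fderiv ℝ f x)) x₀ :=
      continuousAt_const.clm_comp (hfx.fderiv_right (m := 1) (by norm_cast)).continuousAt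
    refine hc.eventually (ContinuousLinearEquiv.isOpen.mem_nhds ?_)
    exact ⟨ContinuousLinearEquiv.refl ℝ V, by ext w; exact (hP w).symm⟩
  have hgood : ∀ᶠ z in 𝓝 (e x₀), ContDiffAt ℝ ∞ g z ∧ fderiv ℝ g z z = g z ∧
        ∀ w, P (fderiv ℝ g z w) = w := by
    have hsymm : Tendsto e.symm (𝓝 (e x₀)) (𝓝 x₀) := by
      have := e.continuousAt_symm (e.map_source hes)
      rwa [ContinuousAt, e.left_inv hes] at this
    filter_upwards [hsymm.eventually hiso, hsymm.eventually hf, hsymm.eventually htan,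
      e.open_target.mem_nhds (e.map_source hes)] with z ⟨A, hA⟩ hfz ⟨v, hv⟩ hz
    have hsmooth : ContDiffAt ℝ ∞ e.symm z := by
      refine e.contDiffAt_symm hz (f₀' := A) ?_ ?_
      · rw [hA]
        exact (hhd hfz).congr_of_eventuallyEq (Eventually.of_forall hec)
      · exact (P.contDiff.contDiffAt.comp _ hfz).congr_of_eventuallyEq (Eventually.of_forall hec)
    have hgs : ContDiffAt ℝ ∞ g z := ContDiffAt.comp z hfz hsmooth
    have hgd := (hgs.differentiableAt (by simp)).hasFDerivAt
    have hPg : ∀ w, P (fderiv ℝ g z w) = w := by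
      have h1 : (fun z => P (g z)) =ᶠ[𝓝 z] id := by
        filter_upwards [e.open_target.mem_nhds hz] with y hy
        exact (hec _).symm.trans (e.right_inv hy)
      have h2 := (P.hasFDerivAt.comp z hgd).fderiv.symm.trans h1.fderiv_eq
      rw [fderiv_id] at h2
      exact fun w => DFunLike.congr_fun h2 w
    refine ⟨hgs, ?_, hPg⟩
    -- Since `f = g ∘ h`, tangency reads `g z = dg_z(w)` for some `w`. Applying `P`, a left inverse
    -- of both `g` and `dg_z`, gives `w = z`.
    have h3 : fderiv ℝ f (e.symm z) = (fderiv ℝ g z).comp (P.comp (fderiv ℝ f (e.symm z))) := by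
      have h4 : f =ᶠ[𝓝 (e.symm z)] fun x => g (h x) := by
        filter_upwards [e.open_source.mem_nhds (e.map_target hz)] with y hy
        rw [hg, ← hec]
        simp only [e.left_inv hy]
      refine h4.fderiv_eq.trans
        (HasFDerivAt.comp (g := g) (f := h) (e.symm z) ?_ (hhd hfz)).fderiv
      rwa [← hec, e.right_inv hz]
    have h5 : g z = fderiv ℝ g z (P (fderiv ℝ f (e.symm z) v)) := by
      rw [hg]
      simp only [hv]
      exact DFunLike.congr_fun h3 v
    have h6 : P (g z) = z := by
      rw [hg, ← hh] at *
      exact (hec _).symm.trans (e.right_inv hz)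
    rw [h5, hPg] at h6
    rw [h5, h6]
  obtain ⟨r, hr, hball⟩ := Metric.eventually_nhds_iff_ball.1 hgood
  refine ⟨e x₀, g, P, r, ?_, hr, hball, h, ?_, ?_⟩
  · obtain ⟨v, hv⟩ := htan.self_of_nhds
    rw [hec, hh]
    simp only [hv, hP]
    rintro rfl
    exact h0 (by rw [hv, map_zero])
  · rw [hec]; exact hhc.continuousAt
  · filter_upwards [e.open_source.mem_nhds hes] with x hx
    rw [hg, ← hec]
    simp only [e.left_inv hx]

/-- An immersed hypersurface whose position vector is tangent is locally contained in the cone over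
a smooth family of points parametrised by a ball. -/
lemma exists_conic_slice {m : ℕ} (hV : finrank ℝ V = m + 1)
    (hf : ∀ᶠ x in 𝓝 x₀, ContDiffAt ℝ ∞ f x)
    (hinj : Function.Injective (fderiv ℝ f x₀)) (htan : ∀ᶠ x in 𝓝 x₀, ∃ v, f x = fderiv ℝ f x v)
    (h0 : f x₀ ≠ 0) :
    ∃ γ : E m → F, (∀ y ∈ Metric.ball (0 : E m) (1 / 2), ContDiffAt ℝ ∞ γ y ∧
        ∀ t : ℝ, 0 < t → ∀ (a : ℝ) w, a • γ y + t • fderiv ℝ γ y w = 0 → a = 0 ∧ w = 0) ∧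
      ∀ᶠ x in 𝓝 x₀, ∃ t : ℝ, 0 ≤ t ∧ ∃ y ∈ Metric.ball (0 : E m) (1 / 2), f x = t • γ y := by
  obtain ⟨z₀, g, P, r, hz₀, hr, hg, h, hlim, hgraph⟩ := exists_euler_graph hf hinj htan h0
  -- The slice is the affine hyperplane `η = 1` through `z₀`, transverse to the rays; `η` is the
  -- radial parameter.
  obtain ⟨η, hη⟩ := SeparatingDual.exists_eq_one (R := ℝ) hz₀
  have hη0 : η.toLinearMap ≠ 0 := by
    intro h
    have := LinearMap.congr_fun h z₀
    simp [hη] at this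
  have hk : finrank ℝ (E m) = finrank ℝ (LinearMap.ker η.toLinearMap) := by
    have := Module.Dual.finrank_ker_add_one_of_ne_zero hη0
    rw [finrank_euclideanSpace_fin]
    omega
  let i₀ := LinearEquiv.ofFinrankEq _ _ hk
  set i : E m →L[ℝ] V := LinearMap.toContinuousLinearMap
    ((LinearMap.ker η.toLinearMap).subtype.comp i₀.toLinearMap) with hi
  have hηi : ∀ y, η (i y) = 0 := fun y => (i₀ y).2
  have hi_inj : Function.Injective i := Subtype.val_injective.comp i₀.injective
  have hi_surj : ∀ z, η z = 0 → ∃ y, i y = z := fun z hz =>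
    ⟨i₀.symm ⟨z, hz⟩, by simp [hi]⟩
  obtain ⟨k', hk'⟩ := i.toLinearMap.exists_leftInverse_of_injective (LinearMap.ker_eq_bot.2 hi_inj)
  set k : V →L[ℝ] E m := LinearMap.toContinuousLinearMap k' with hkdef
  have hki : ∀ y, k (i y) = y := fun y => LinearMap.congr_fun hk' y
  have hik : ∀ z, η z = 0 → i (k z) = z := fun z hz => by
    obtain ⟨y, rfl⟩ := hi_surj z hz
    rw [hki]
  obtain ⟨δ, hδ, hδr⟩ : ∃ δ > 0, ∀ y ∈ Metric.ball (0 : E m) δ, z₀ + i y ∈ Metric.ball z₀ r := by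
    have hc : ContinuousAt (fun y => z₀ + i y) 0 := by fun_prop
    exact Metric.eventually_nhds_iff_ball.1
      (hc.eventually (Metric.isOpen_ball.mem_nhds (by simpa using hr)))
  -- The factor `2 * δ` rescales the ball of radius `1 / 2` to radius `δ`.
  set j : E m → V := fun y => z₀ + i ((2 * δ) • y) with hj
  have hjball : ∀ y ∈ Metric.ball (0 : E m) (1 / 2), j y ∈ Metric.ball z₀ r := fun y hy =>
    hδr _ (by
      rw [mem_ball_zero_iff] at hy ⊢
      rw [norm_smul, Real.norm_of_nonneg (by positivity)]
      nlinarith)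
  have hjd : ∀ y, HasFDerivAt j ((2 * δ) • i) y := fun y => by
    have := (((2 * δ) • i).hasFDerivAt (x := y)).const_add z₀
    simpa [hj] using this
  refine ⟨fun y => g (j y), fun y hy => ?_, ?_⟩
  · obtain ⟨h1, h2, h3⟩ := hg _ (hjball y hy)
    refine ⟨ContDiffAt.comp y h1 ?_, fun t ht a w haw => ?_⟩
    · exact (contDiff_const.add (i.contDiff.comp (contDiff_id.const_smul (2 * δ)))).contDiffAt
    have h4 := ((h1.differentiableAt (by simp)).hasFDerivAt.comp y (hjd y)).fderiv
    rw [show (fun y => g (j y)) = g ∘ j from rfl, h4, Function.comp_apply, ← h2] at haw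
    -- Applying `P` reduces the immersion condition to one in `V`; there `η` isolates `a`, because
    -- `η (j y) = 1` and `η` vanishes on the image of `i`.
    have h5 := congrArg P haw
    simp only [map_add, map_smul, ContinuousLinearMap.comp_apply, _root_.smul_apply, h3,
      map_zero] at h5
    have h6 := congrArg η h5
    have hηj : η (j y) = 1 := by simp [hj, hηi, hη]
    simp only [map_add, map_smul, hηj, hηi, map_zero, smul_eq_mul, mul_zero, add_zero,
      mul_one] at h6
    refine ⟨h6, hi_inj ?_⟩
    rw [h6, zero_smul, zero_add, smul_smul] at h5
    simpa [ht.ne', hδ.ne'] using h5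
  · have hc1 : ContinuousAt (fun z => (η z)⁻¹ • z) z₀ :=
      (η.continuous.continuousAt.inv₀ (by simp [hη])).smul continuousAt_id
    have hc2 : ContinuousAt (fun z => k ((η z)⁻¹ • z - z₀)) z₀ :=
      k.continuous.continuousAt.comp (f := fun z => (η z)⁻¹ • z - z₀)
        (hc1.sub continuousAt_const)
    have hc3 : ContinuousAt (fun z => (2 * δ)⁻¹ • k ((η z)⁻¹ • z - z₀)) z₀ :=
      ContinuousAt.fun_const_smul hc2 _
    have e1 : ∀ᶠ z in 𝓝 z₀, z ∈ Metric.ball z₀ r := Metric.ball_mem_nhds z₀ hr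
    have e2 : ∀ᶠ z in 𝓝 z₀, (2 * δ)⁻¹ • k ((η z)⁻¹ • z - z₀) ∈ Metric.ball (0 : E m) (1 / 2) :=
      hc3.eventually (Metric.isOpen_ball.mem_nhds (by simp [hη]))
    have e3 : ∀ᶠ z in 𝓝 z₀, 0 < η z :=
      η.continuous.continuousAt.eventually (lt_mem_nhds (by rw [hη]; exact one_pos))
    filter_upwards [hgraph, hlim.eventually e1, hlim.eventually e2, hlim.eventually e3]
      with x hx h1 h2 h3
    have hjz : j ((2 * δ)⁻¹ • k ((η (h x))⁻¹ • h x - z₀)) = (η (h x))⁻¹ • h x := by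
      rw [hj]
      simp only [smul_inv_smul₀ (show (2 * δ) ≠ 0 by positivity)]
      rw [hik _ (by simp [hη, h3.ne'])]
      abel
    refine ⟨η (h x), h3.le, _, h2, ?_⟩
    have h4 := hjball _ h2
    simp only [hjz] at h4 ⊢
    rw [hx, ← homogeneous_of_euler (fun z hz => ⟨(hg z hz).1.differentiableAt (by simp),
      (hg z hz).2.1⟩) h4 h3 (by rwa [smul_inv_smul₀ h3.ne']), smul_inv_smul₀ h3.ne']

end Cone

/-! ### Differentials, vector fields and Lie brackets in charts. -/

noncomputable section Charts

variable {n : ℕ} {M : Type*} [TopologicalSpace M] [ChartedSpace (E n) M]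
  {G : Type*} [NormedAddCommGroup G] [NormedSpace ℝ G]

/-- The differential of a function `h` on `M` with values in a normed space. -/
def mderiv (n : ℕ) {M : Type*} [TopologicalSpace M] [ChartedSpace (E n) M]
    {G : Type*} [NormedAddCommGroup G] [NormedSpace ℝ G] (h : M → G) (p : M) :
    TangentSpace (𝓡 n) p →L[ℝ] G :=
  mfderiv (𝓡 n) 𝓘(ℝ, G) h p

/-- The tangent space at `p` is identified with `E n` by the chart at `p` itself, so no transition
map enters; at other points `fderiv_chart_eq` has the factor `chartSymmDeriv`. -/
lemma mderiv_eq_fderiv_chart {h : M → G} {p : M} (hh : MDifferentiableAt (𝓡 n) 𝓘(ℝ, G) h p)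
    (u : E n) :
    mderiv n h p u =
      fderiv ℝ (fun y => h ((extChartAt (𝓡 n) p).symm y)) (extChartAt (𝓡 n) p p) u := by
  rw [mderiv, hh.mfderiv]
  simp only [writtenInExtChartAt, modelWithCornersSelf_coe, range_id, fderivWithin_univ]
  rfl

lemma differentiableAt_chart {h : M → G} {p : M} (hh : MDifferentiableAt (𝓡 n) 𝓘(ℝ, G) h p) :
    DifferentiableAt ℝ (fun y => h ((extChartAt (𝓡 n) p).symm y)) (extChartAt (𝓡 n) p p) := by
  have := hh.differentiableWithinAt_writtenInExtChartAt
  simp only [writtenInExtChartAt, modelWithCornersSelf_coe, range_id,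
    differentiableWithinAt_univ] at this
  exact this

variable [IsManifold (𝓡 n) ∞ M]

/-- The differential of the inverse of the chart at `p`. -/
def chartSymmDeriv (n : ℕ) {M : Type*} [TopologicalSpace M] [ChartedSpace (E n) M] (p : M)
    (y : E n) : E n →L[ℝ] TangentSpace (𝓡 n) ((extChartAt (𝓡 n) p).symm y) :=
  mfderivWithin 𝓘(ℝ, E n) (𝓡 n) (extChartAt (𝓡 n) p).symm (range (𝓡 n)) y

lemma isInvertible_chartSymmDeriv {p : M} {y : E n} (hy : y ∈ (extChartAt (𝓡 n) p).target) :
    (chartSymmDeriv n p y).IsInvertible :=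
  have : IsManifold (𝓡 n) 1 M := IsManifold.of_le (n := ∞) (by norm_cast)
  isInvertible_mfderivWithin_extChartAt_symm hy

lemma fderiv_chart_eq {h : M → G} {p : M} {y : E n} (hy : y ∈ (extChartAt (𝓡 n) p).target)
    (hh : MDifferentiableAt (𝓡 n) 𝓘(ℝ, G) h ((extChartAt (𝓡 n) p).symm y)) (u : E n) :
    fderiv ℝ (fun y => h ((extChartAt (𝓡 n) p).symm y)) y u =
      mderiv n h ((extChartAt (𝓡 n) p).symm y) (chartSymmDeriv n p y u) := by
  have : IsManifold (𝓡 n) 1 M := IsManifold.of_le (n := ∞) (by norm_cast)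
  have h1 : MDifferentiableAt 𝓘(ℝ, E n) (𝓡 n) (extChartAt (𝓡 n) p).symm y := by
    have := mdifferentiableWithinAt_extChartAt_symm (I := 𝓡 n) hy
    simpa [mdifferentiableWithinAt_univ] using this
  have h2 := mfderiv_comp y hh h1
  have h3 : chartSymmDeriv n p y = mfderiv 𝓘(ℝ, E n) (𝓡 n) (extChartAt (𝓡 n) p).symm y := by
    simp [chartSymmDeriv, mfderivWithin_univ]
    rfl
  rw [h3, ← mfderiv_eq_fderiv]
  exact DFunLike.congr_fun h2 u

lemma contDiffAt_chart {h : M → G} {p : M} {y : E n} (hy : y ∈ (extChartAt (𝓡 n) p).target)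
    (hh : ContMDiff (𝓡 n) 𝓘(ℝ, G) ∞ h) :
    ContDiffAt ℝ ∞ (fun y => h ((extChartAt (𝓡 n) p).symm y)) y := by
  rw [← contMDiffAt_iff_contDiffAt]
  refine ContMDiffAt.comp y (hh _) ?_
  exact (contMDiffOn_extChartAt_symm p).contMDiffAt
    ((isOpen_extChartAt_target (I := 𝓡 n) p).mem_nhds hy)

/-- The coordinate expression of a vector field in the chart at `p`. -/
def chartField (X : ∀ q : M, TangentSpace (𝓡 n) q) (p : M) : E n → E n :=
  VectorField.mpullbackWithin 𝓘(ℝ, E n) (𝓡 n) (extChartAt (𝓡 n) p).symm X (range (𝓡 n))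

lemma chartSymmDeriv_chartField (X : ∀ q : M, TangentSpace (𝓡 n) q) {p : M} {y : E n}
    (hy : y ∈ (extChartAt (𝓡 n) p).target) :
    chartSymmDeriv n p y (chartField X p y) = X ((extChartAt (𝓡 n) p).symm y) :=
  (isInvertible_chartSymmDeriv hy).self_apply_inverse _

lemma differentiableAt_chartField {X : ∀ q : M, TangentSpace (𝓡 n) q} (hX : IsSmoothVectorField X)
    (p : M) : DifferentiableAt ℝ (chartField X p) (extChartAt (𝓡 n) p p) := by
  have : IsManifold (𝓡 n) 1 M := IsManifold.of_le (n := ∞) (by norm_cast)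
  have : IsManifold (𝓡 n) (minSmoothness ℝ 2) M := by
    simpa using IsManifold.of_le (I := 𝓡 n) (M := M) (m := 2) (n := ∞) (by norm_cast)
  have h1 := (hX p).mdifferentiableAt (by simp)
  have := (mdifferentiableWithinAt_univ.2 h1).differentiableWithinAt_mpullbackWithin_vectorField
  simp only [preimage_univ, univ_inter, modelWithCornersSelf_coe, range_id] at this
  rw [← differentiableWithinAt_univ]
  simpa only [chartField, modelWithCornersSelf_coe, range_id] using this

lemma contMDiff_mderiv_apply {h : M → G} (hh : ContMDiff (𝓡 n) 𝓘(ℝ, G) ∞ h)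
    {X : ∀ q : M, TangentSpace (𝓡 n) q} (hX : IsSmoothVectorField X) :
    ContMDiff (𝓡 n) 𝓘(ℝ, G) ∞ (fun q => mderiv n h q (X q)) := by
  have : IsManifold (𝓡 n) 1 M := IsManifold.of_le (n := ∞) (by norm_cast)
  have h1 := hh.contMDiff_tangentMap (m := ∞) (by norm_cast)
  exact (contMDiff_snd_tangentBundle_modelSpace G 𝓘(ℝ, G)).comp (h1.comp hX)

/-- The Lie bracket is the commutator of derivatives along vector fields. -/
lemma mderiv_mlieBracket {h : M → G} (hh : ContMDiff (𝓡 n) 𝓘(ℝ, G) ∞ h)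
    {X Y : ∀ q : M, TangentSpace (𝓡 n) q} (hX : IsSmoothVectorField X)
    (hY : IsSmoothVectorField Y) (p : M) :
    (mderiv n h p (VectorField.mlieBracket (𝓡 n) X Y p) : G) =
      mderiv n (fun q => mderiv n h q (Y q)) p (X p) -
        mderiv n (fun q => mderiv n h q (X q)) p (Y p) := by
  have : IsManifold (𝓡 n) 1 M := IsManifold.of_le (n := ∞) (by norm_cast)
  have hmd : ∀ {k : M → G}, ContMDiff (𝓡 n) 𝓘(ℝ, G) ∞ k → ∀ q, MDifferentiableAt (𝓡 n) 𝓘(ℝ, G) k q :=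
    fun hk q => (hk q).mdifferentiableAt (by simp)
  set e := extChartAt (𝓡 n) p with he
  set y₀ := e p with hy₀
  have hy : y₀ ∈ e.target := mem_extChartAt_target p
  have hp : e.symm y₀ = p := extChartAt_to_inv p
  set f : E n → G := fun y => h (e.symm y) with hf
  have hfs : ContDiffAt ℝ ∞ f y₀ := contDiffAt_chart hy hh
  have key : ∀ {k : M → G} (_ : ContMDiff (𝓡 n) 𝓘(ℝ, G) ∞ k) (Z : ∀ q : M, TangentSpace (𝓡 n) q)
      {y : E n} (_ : y ∈ e.target),
      fderiv ℝ (fun y => k (e.symm y)) y (chartField Z p y) =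
        mderiv n k (e.symm y) (Z (e.symm y)) := by
    intro k hk Z y hy
    rw [fderiv_chart_eq hy (hmd hk _), chartSymmDeriv_chartField Z hy]
  -- In coordinates `Z (Y h) = D²f(Z, Y) + Df(DY(Z))`; the Hessian terms cancel in the commutator.
  have main : ∀ {Y Z : ∀ q : M, TangentSpace (𝓡 n) q}, IsSmoothVectorField Y →
      (mderiv n (fun q => mderiv n h q (Y q)) p (Z p) : G) =
        fderiv ℝ (fderiv ℝ f) y₀ (chartField Z p y₀) (chartField Y p y₀) +
          fderiv ℝ f y₀ (fderiv ℝ (chartField Y p) y₀ (chartField Z p y₀)) := by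
    intro Y Z hY
    have h1 := key (contMDiff_mderiv_apply hh hY) Z hy
    rw [hp] at h1
    rw [← h1]
    have h2 : (fun y => (mderiv n h (e.symm y) (Y (e.symm y)) : G)) =ᶠ[𝓝 y₀]
        fun y => fderiv ℝ f y (chartField Y p y) := by
      filter_upwards [(isOpen_extChartAt_target (I := 𝓡 n) p).mem_nhds hy] with y hy
      exact (key hh Y hy).symm
    rw [h2.fderiv_eq]
    have h3 : HasFDerivAt (fderiv ℝ f) (fderiv ℝ (fderiv ℝ f) y₀) y₀ :=
      ((hfs.fderiv_right (m := 1) (by norm_cast)).differentiableAt (by simp)).hasFDerivAt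
    rw [(h3.clm_apply (differentiableAt_chartField hY p).hasFDerivAt).fderiv]
    simp only [_root_.add_apply, ContinuousLinearMap.comp_apply, ContinuousLinearMap.flip_apply]
    exact add_comm _ _
  have hsym : IsSymmSndFDerivAt ℝ f y₀ := hfs.isSymmSndFDerivAt (by
    rw [minSmoothness_of_isRCLikeNormedField]
    exact WithTop.coe_le_coe.2 (by exact_mod_cast le_top))
  rw [main hX, main hY, hsym]
  have hbr : (mderiv n h p (VectorField.mlieBracket (𝓡 n) X Y p) : G) =
      fderiv ℝ f y₀ (fderiv ℝ (chartField Y p) y₀ (chartField X p y₀) -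
        fderiv ℝ (chartField X p) y₀ (chartField Y p y₀)) := by
    have h1 : VectorField.mlieBracket (𝓡 n) X Y p =
        (mderiv n e p).inverse (fderiv ℝ (chartField Y p) y₀ (chartField X p y₀) -
            fderiv ℝ (chartField X p) y₀ (chartField Y p y₀)) := by
      rw [← VectorField.mlieBracketWithin_univ, VectorField.mlieBracketWithin_apply]
      simp only [preimage_univ, univ_inter, VectorField.lieBracketWithin,
        modelWithCornersSelf_coe, range_id]
      rw [← fderivWithin_univ, ← fderivWithin_univ]
      simp only [chartField, modelWithCornersSelf_coe, range_id]
      rfl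
    have hinv : (mderiv n e p).IsInvertible :=
      isInvertible_mfderiv_extChartAt (mem_extChartAt_source p)
    have hid : mderiv n e p = ContinuousLinearMap.id ℝ (E n) := by
      refine ContinuousLinearMap.ext fun u => (mderiv_eq_fderiv_chart
        (mdifferentiableAt_extChartAt (mem_chart_source _ p)) u).trans ?_
      have : (fun y => e (e.symm y)) =ᶠ[𝓝 y₀] id := by
        filter_upwards [(isOpen_extChartAt_target (I := 𝓡 n) p).mem_nhds hy] with y hy
        exact e.right_inv hy
      exact DFunLike.congr_fun (this.fderiv_eq.trans fderiv_id) u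
    rw [h1, show (mderiv n e p).inverse (fderiv ℝ (chartField Y p) y₀ (chartField X p y₀) -
      fderiv ℝ (chartField X p) y₀ (chartField Y p y₀)) = _ from
        (DFunLike.congr_fun hid _).symm.trans (hinv.self_apply_inverse _)]
    exact mderiv_eq_fderiv_chart (hmd hh p) _
  rw [hbr, map_sub]
  abel

/-- A tangent vector extends to a smooth vector field. -/
lemma exists_isSmoothVectorField [T2Space M] [SecondCountableTopology M] (p : M)
    (u : TangentSpace (𝓡 n) p) :
    ∃ X : ∀ q : M, TangentSpace (𝓡 n) q, IsSmoothVectorField X ∧ X p = u := by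
  classical
  have : LocallyCompactSpace M := ChartedSpace.locallyCompactSpace (E n) M
  have : SigmaCompactSpace M := inferInstance
  -- The value is prescribed at `p` and free elsewhere; this is fibrewise convex, so local
  -- extensions can be glued.
  let t : ∀ q : M, Set (TangentSpace (𝓡 n) q) := fun q => {v | ∀ h : p = q, v = h ▸ u}
  have hconv : ∀ q, Convex ℝ (t q) := by
    intro q
    by_cases h : p = q
    · subst h
      have : t p = {u} := by ext v; simp [t]
      rw [this]; exact convex_singleton _
    · have : t q = univ := by ext v; simp [t, h]
      rw [this]; exact convex_univ
  obtain ⟨s, hs⟩ := exists_contMDiffSection_forall_mem_convex_of_local (𝓡 n) (n := (⊤ : ℕ∞))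
    (F_fiber := E n) (fun q : M => TangentSpace (𝓡 n) q) t hconv fun q => by
      by_cases h : p = q
      · subst h
        obtain ⟨W, hW, hsm⟩ := FiberBundle.exists_contMDiffOn_extend (𝓡 n) (E n) (k := ∞)
          (V := fun q : M => TangentSpace (𝓡 n) q) u
        refine ⟨W, hW, _, hsm, ?_⟩
        rintro y hy rfl
        exact FiberBundle.extend_apply_self (E n) u
      · refine ⟨{p}ᶜ, isOpen_compl_singleton.mem_nhds (by simpa using Ne.symm h), 0, ?_, ?_⟩
        · exact (Bundle.contMDiff_zeroSection ℝ (fun q : M => TangentSpace (𝓡 n) q)).contMDiffOn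
        · intro y hy hpy
          exact (hy hpy.symm).elim
  exact ⟨s, s.contMDiff, hs p rfl⟩

end Charts

/-! ### The soliton equation as a condition on the shape operator. -/

noncomputable section Soliton

/-- The flat metric as a continuous bilinear form. -/
def flatForm (m s : ℕ) : E m →L[ℝ] E m →L[ℝ] ℝ :=
  LinearMap.toContinuousLinearMap
    ((LinearMap.toContinuousLinearMap (𝕜 := ℝ) (E := E m) (F' := ℝ)).toLinearMap ∘ₗ flatMetric m s)

lemma flatForm_apply (m s : ℕ) (x y : E m) : flatForm m s x y = flatMetric m s x y := rfl

lemma flatForm_comm (m s : ℕ) (x y : E m) : flatForm m s x y = flatForm m s y x := by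
  simp only [flatForm_apply, flatMetric, LinearMap.mk₂_apply]
  exact Finset.sum_congr rfl fun i _ => by ring

lemma flatForm_nondegenerate (m s : ℕ) (x : E m) (h : ∀ y, flatForm m s x y = 0) : x = 0 := by
  ext i
  have := h (EuclideanSpace.single i 1)
  simp only [flatForm_apply, flatMetric, LinearMap.mk₂_apply] at this
  rw [Finset.sum_eq_single i (fun j _ hj => by simp [hj]) (by simp)] at this
  split_ifs at this <;> simpa using this

variable {n s : ℕ} {M : Type*} [TopologicalSpace M] [ChartedSpace (E n) M] {ψ : M → E (n + 1)}

/-- The normal part of the position vector. -/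
def normalPosition (h : IsPseudoRiemannianHypersurface s ψ) (p : M) : E (n + 1) :=
  ψ p - mderiv n ψ p (tangentialPosition h p)

lemma flatForm_normalPosition (h : IsPseudoRiemannianHypersurface s ψ) (p : M)
    (w : TangentSpace (𝓡 n) p) :
    flatForm (n + 1) s (normalPosition h p) (mderiv n ψ p w) = 0 :=
  flatMetric_sub_tangentialPosition h p w

lemma inducedMetric_eq (p : M) (u w : TangentSpace (𝓡 n) p) :
    inducedMetric n s ψ p u w = flatForm (n + 1) s (mderiv n ψ p u) (mderiv n ψ p w) := rfl

lemma nondegenerate_mderiv (h : IsPseudoRiemannianHypersurface s ψ) (p : M)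
    (u : TangentSpace (𝓡 n) p)
    (hu : ∀ w, flatForm (n + 1) s (mderiv n ψ p u) (mderiv n ψ p w) = 0) : u = 0 :=
  (h.nondegenerate p).1 u hu

lemma mderiv_bilin {G : Type*} [NormedAddCommGroup G] [NormedSpace ℝ G] (B : G →L[ℝ] G →L[ℝ] ℝ)
    {g h : M → G} (hg : ContMDiff (𝓡 n) 𝓘(ℝ, G) ∞ g) (hh : ContMDiff (𝓡 n) 𝓘(ℝ, G) ∞ h) (p : M)
    (u : TangentSpace (𝓡 n) p) :
    mderiv n (fun q => B (g q) (h q)) p u =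
      B (g p) (mderiv n h p u) + B (mderiv n g p u) (h p) := by
  have hg' := (hg p).mdifferentiableAt (by simp)
  have hh' := (hh p).mdifferentiableAt (by simp)
  have hgh : ContMDiff (𝓡 n) 𝓘(ℝ, ℝ) ∞ (fun q => B (g q) (h q)) :=
    (B.contDiff.contMDiff.comp hg).clm_apply hh
  have h1 := hasFDerivAt_bilin (B := B) (differentiableAt_chart hg').hasFDerivAt
    (differentiableAt_chart hh').hasFDerivAt u
  simp only [extChartAt_to_inv] at h1
  refine (mderiv_eq_fderiv_chart ((hgh p).mdifferentiableAt (by simp)) u).trans (h1.trans ?_)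
  rw [← show mderiv n h p u = _ from mderiv_eq_fderiv_chart hh' u,
    ← show mderiv n g p u = _ from mderiv_eq_fderiv_chart hg' u]

variable [IsManifold (𝓡 n) ∞ M]

lemma contMDiff_normalPosition (h : IsPseudoRiemannianHypersurface s ψ)
    (hV : IsSmoothVectorField (tangentialPosition h)) :
    ContMDiff (𝓡 n) 𝓘(ℝ, E (n + 1)) ∞ (normalPosition h) :=
  h.smooth.sub (contMDiff_mderiv_apply h.smooth hV)

/-- For a conformal soliton, the shape operator of the normal part of the position vector is a
multiple of the identity. -/
lemma mderiv_normalPosition [T2Space M] [SecondCountableTopology M]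
    (h : IsPseudoRiemannianHypersurface s ψ) {φ : M → ℝ}
    (hsol : IsConformalSoliton (inducedMetric n s ψ) (tangentialPosition h) φ) (p : M)
    (u w : TangentSpace (𝓡 n) p) :
    flatForm (n + 1) s (mderiv n (normalPosition h) p u) (mderiv n ψ p w) =
      (1 - φ p) * flatForm (n + 1) s (mderiv n ψ p u) (mderiv n ψ p w) := by
  obtain ⟨Y, hY, rfl⟩ := exists_isSmoothVectorField p u
  obtain ⟨Z, hZ, rfl⟩ := exists_isSmoothVectorField p w
  set B := flatForm (n + 1) s with hB
  have hBs := flatForm_comm (n + 1) s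
  set V := tangentialPosition h with hVdef
  have hV : IsSmoothVectorField V := hsol.smooth_field
  have hN := contMDiff_normalPosition h hV
  have hYs := contMDiff_mderiv_apply h.smooth hY
  have hZs := contMDiff_mderiv_apply h.smooth hZ
  -- From `dψ(V) = ψ - N`. With brackets as commutators, `L_V g (Y, Z)` becomes `2 g(Y, Z)` minus
  -- the two pairings of `dN` with `dψ`.
  have hdV : ∀ z, mderiv n (fun q => mderiv n ψ q (V q)) p z =
      mderiv n ψ p z - mderiv n (normalPosition h) p z := by
    intro z
    have h1 : (fun q => mderiv n ψ q (V q)) = ψ - normalPosition h := by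
      funext q; simp [normalPosition, hVdef]
    rw [h1]
    exact DFunLike.congr_fun (mfderiv_sub ((h.smooth p).mdifferentiableAt (by simp))
      ((hN p).mdifferentiableAt (by simp))) z
  have hnorm : ∀ {X : ∀ q : M, TangentSpace (𝓡 n) q} (_ : IsSmoothVectorField X) (z),
      B (mderiv n (normalPosition h) p z) (mderiv n ψ p (X p)) =
        - B (normalPosition h p) (mderiv n (fun q => mderiv n ψ q (X q)) p z) := by
    intro X hX z
    have h1 := mderiv_bilin B hN (contMDiff_mderiv_apply h.smooth hX) p z
    have h2 : (fun q => B (normalPosition h q) (mderiv n ψ q (X q))) = fun _ => 0 := by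
      funext q; exact flatForm_normalPosition h q _
    have h3 : mderiv n (fun _ : M => (0 : ℝ)) p z = 0 := by
      rw [mderiv, mfderiv_const]; rfl
    rw [h2, h3] at h1
    linarith
  -- Symmetry of the second fundamental form: `N` is orthogonal to `dψ [Y, Z]`. Hence the two
  -- pairings agree.
  have hsymm : B (mderiv n (normalPosition h) p (Y p)) (mderiv n ψ p (Z p)) =
      B (mderiv n (normalPosition h) p (Z p)) (mderiv n ψ p (Y p)) := by
    have h1 := flatForm_normalPosition h p (VectorField.mlieBracket (𝓡 n) Y Z p)
    rw [mderiv_mlieBracket h.smooth hY hZ p, map_sub] at h1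
    rw [hnorm hZ, hnorm hY]
    linarith
  have heq := hsol.eq Y Z hY hZ p
  have hd : dirDeriv (fun q => inducedMetric n s ψ q (Y q) (Z q)) p (V p) =
      B (mderiv n ψ p (Y p)) (mderiv n (fun q => mderiv n ψ q (Z q)) p (V p)) +
        B (mderiv n (fun q => mderiv n ψ q (Y q)) p (V p)) (mderiv n ψ p (Z p)) :=
    mderiv_bilin B hYs hZs p (V p)
  rw [lieDerivative, hd] at heq
  simp only [inducedMetric_eq, ← hB] at heq
  rw [mderiv_mlieBracket h.smooth hV hY p, mderiv_mlieBracket h.smooth hV hZ p, hdV, hdV] at heq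
  simp only [map_sub, _root_.sub_apply] at heq
  rw [hBs (mderiv n ψ p (Y p)) (mderiv n (normalPosition h) p (Z p)), ← hsymm] at heq
  linarith

/-- The coordinate expression of a conformal soliton hypersurface. -/
lemma isSolitonAt_chart [T2Space M] [SecondCountableTopology M]
    (h : IsPseudoRiemannianHypersurface s ψ) {φ : M → ℝ}
    (hsol : IsConformalSoliton (inducedMetric n s ψ) (tangentialPosition h) φ) (p : M) :
    IsSolitonAt (flatForm (n + 1) s) (fun y => ψ ((extChartAt (𝓡 n) p).symm y))
      (fun y => normalPosition h ((extChartAt (𝓡 n) p).symm y))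
      (fun y => φ ((extChartAt (𝓡 n) p).symm y)) (extChartAt (𝓡 n) p p) := by
  have hN := contMDiff_normalPosition h hsol.smooth_field
  have hmem := mem_extChartAt_target (I := 𝓡 n) p
  have htarget := (isOpen_extChartAt_target (I := 𝓡 n) p).mem_nhds hmem
  have hd : ∀ {k : M → E (n + 1)}, ContMDiff (𝓡 n) 𝓘(ℝ, E (n + 1)) ∞ k →
      ∀ {y}, y ∈ (extChartAt (𝓡 n) p).target → ∀ u : E n,
      fderiv ℝ (fun y => k ((extChartAt (𝓡 n) p).symm y)) y u =
        mderiv n k ((extChartAt (𝓡 n) p).symm y) (chartSymmDeriv n p y u) := fun hk _ hy u =>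
    fderiv_chart_eq hy ((hk _).mdifferentiableAt (by simp)) u
  refine ⟨(contDiffAt_chart hmem h.smooth).of_le
    (WithTop.coe_le_coe.2 (by exact_mod_cast le_top)), fun u hu => ?_, ?_, ?_, ?_⟩
  · have hinv := isInvertible_chartSymmDeriv hmem
    refine hinv.injective ((nondegenerate_mderiv h _ _ fun w => ?_).trans (map_zero _).symm)
    obtain ⟨w, rfl⟩ := hinv.surjective w
    rw [← hd h.smooth hmem, ← hd h.smooth hmem]
    exact hu w
  · filter_upwards [htarget] with y hy u
    rw [hd h.smooth hy]
    exact flatForm_normalPosition h _ _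
  · filter_upwards [htarget] with y hy
    obtain ⟨v, hv⟩ := (isInvertible_chartSymmDeriv hy).surjective (tangentialPosition h _)
    refine ⟨v, ?_⟩
    rw [hd h.smooth hy, hv, normalPosition, add_sub_cancel]
  · filter_upwards [htarget] with y hy u w
    rw [hd h.smooth hy, hd h.smooth hy, hd hN hy]
    exact mderiv_normalPosition h hsol _ _ _

end Soliton

/-! ### Assembling countably many conic pieces. -/

section Cone

variable {n : ℕ}

lemma contDiffAt_congr_fderiv_translate {V F : Type*} [NormedAddCommGroup V] [NormedSpace ℝ V]
    [NormedAddCommGroup F] [NormedSpace ℝ F] {g γ : V → F} {c x : V}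
    (h : g =ᶠ[𝓝 x] fun z => γ (z - c)) (hγ : ContDiffAt ℝ ∞ γ (x - c)) :
    ContDiffAt ℝ ∞ g x ∧ fderiv ℝ g x = fderiv ℝ γ (x - c) := by
  refine ⟨ContDiffAt.congr_of_eventuallyEq ?_ h, by rw [h.fderiv_eq, fderiv_comp_sub]⟩
  exact ContDiffAt.comp x hγ (contDiffAt_id.sub contDiffAt_const)

open TopologicalSpace in
lemma mderiv_opens {m : ℕ} {G : Type*} [NormedAddCommGroup G] [NormedSpace ℝ G] (U : Opens (E m))
    {g : E m → G} (y : U) (hg : ContDiffAt ℝ ∞ g y) (u : E m) :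
    ContMDiffAt (𝓡 m) 𝓘(ℝ, G) ∞ (fun z : U => g z) y ∧
      mderiv m (fun z : U => g z) y u = fderiv ℝ g y u := by
  have hs : ContMDiffAt (𝓡 m) 𝓘(ℝ, G) ∞ (fun z : U => g z) y :=
    ContMDiffAt.comp y hg.contMDiffAt contMDiff_subtype_val.contMDiffAt
  refine ⟨hs, (mderiv_eq_fderiv_chart (hs.mdifferentiableAt (by simp)) u).trans ?_⟩
  have hval : ∀ z : U, extChartAt (𝓡 m) y z = (z : E m) := fun z => rfl
  have heq : (fun z => g ((extChartAt (𝓡 m) y).symm z : U)) =ᶠ[𝓝 (extChartAt (𝓡 m) y y)] g := by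
    filter_upwards [(isOpen_extChartAt_target (I := 𝓡 m) y).mem_nhds (mem_extChartAt_target y)]
      with z hz
    rw [← hval, (extChartAt (𝓡 m) y).right_inv hz]
  rw [heq.fderiv_eq, hval]

/-- The cone over a countable family of pieces parametrised by balls is a conic hypersurface. -/
lemma isConicHypersurface_of_family (hn : 2 ≤ n) (γ : ℕ → E (n - 1) → E (n + 1))
    (hγ : ∀ k, ∀ y ∈ Metric.ball (0 : E (n - 1)) (1 / 2), ContDiffAt ℝ ∞ (γ k) y ∧
      ∀ t : ℝ, 0 < t → ∀ (a : ℝ) w, a • γ k y + t • fderiv ℝ (γ k) y w = 0 → a = 0 ∧ w = 0) :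
    IsConicHypersurface n {x | ∃ t : ℝ, 0 ≤ t ∧ ∃ k, ∃ y ∈ Metric.ball (0 : E (n - 1)) (1 / 2),
      x = t • γ k y} := by
  let i₀ : Fin (n - 1) := ⟨0, by omega⟩
  -- Balls of radius `1 / 2` about these centres are disjoint, and the floor of the first coordinate
  -- recovers `k`. Their union, an open subset of `E (n - 1)`, serves as `L`.
  let c : ℕ → E (n - 1) := fun k => EuclideanSpace.single i₀ ((k : ℝ) + 1 / 2)
  let W : ℕ → Set (E (n - 1)) := fun k => Metric.ball (c k) (1 / 2)
  let U : TopologicalSpace.Opens (E (n - 1)) :=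
    ⟨⋃ k, W k, isOpen_iUnion fun k => Metric.isOpen_ball⟩
  let Γ : E (n - 1) → E (n + 1) := fun x => γ ⌊x i₀⌋₊ (x - c ⌊x i₀⌋₊)
  have hfloor : ∀ k, ∀ x ∈ W k, ⌊x i₀⌋₊ = k := by
    intro k x hx
    have h1 : |x i₀ - (k + 1 / 2)| < 1 / 2 := by
      have h2 := PiLp.norm_apply_le (x - c k) i₀
      have h3 : (x - c k) i₀ = x i₀ - (k + 1 / 2) := by simp [c]
      rw [h3, Real.norm_eq_abs] at h2
      exact h2.trans_lt (mem_ball_iff_norm.1 hx)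
    rw [abs_lt] at h1
    rw [Nat.floor_eq_iff (by linarith [h1.1, (Nat.cast_nonneg k : (0 : ℝ) ≤ k)])]
    constructor <;> linarith [h1.1, h1.2]
  have hΓ : ∀ k, ∀ x ∈ W k, Γ x = γ k (x - c k) := fun k x hx => by
    simp only [Γ, hfloor k x hx]
  have hsub : ∀ k x, x ∈ W k → x - c k ∈ Metric.ball (0 : E (n - 1)) (1 / 2) := fun k x hx =>
    mem_ball_zero_iff.2 (mem_ball_iff_norm.1 hx)
  have hloc : ∀ k, ∀ x ∈ W k, ContDiffAt ℝ ∞ Γ x ∧ fderiv ℝ Γ x = fderiv ℝ (γ k) (x - c k) :=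
    fun k x hx => contDiffAt_congr_fderiv_translate
      (by filter_upwards [Metric.isOpen_ball.mem_nhds hx] with z hz using hΓ k z hz)
      (hγ k _ (hsub k x hx)).1
  have hU : ∀ y : U, ∃ k, (y : E (n - 1)) ∈ W k := fun y => mem_iUnion.1 y.2
  refine ⟨U, inferInstance, inferInstance, inferInstance, inferInstance, inferInstance,
    fun y => Γ y, ?_, ?_, ?_⟩
  · intro y
    obtain ⟨k, hk⟩ := hU y
    exact (mderiv_opens U y (hloc k _ hk).1 0).1
  · intro t ht y a w h
    obtain ⟨k, hk⟩ := hU y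
    have h1 : differential (n - 1) (fun y : U => Γ y) y w = fderiv ℝ (γ k) (y - c k) w :=
      (mderiv_opens U y (hloc k _ hk).1 w).2.trans (by rw [(hloc k _ hk).2])
    have h2 : (fun y : U => Γ y) y = γ k (y - c k) := hΓ k _ hk
    rw [h1, h2] at h
    exact (hγ k _ (hsub k _ hk)).2 t ht a w h
  · ext x
    constructor
    · rintro ⟨t, ht, k, y, hy, rfl⟩
      have hyk : y + c k ∈ W k := by
        rw [mem_ball_zero_iff] at hy
        simpa [W, mem_ball_iff_norm] using hy
      refine ⟨t, ht, ⟨y + c k, mem_iUnion.2 ⟨k, hyk⟩⟩, ?_⟩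
      have h2 : Γ (y + c k) = γ k y := by rw [hΓ k _ hyk, add_sub_cancel_right]
      rw [← h2]
    · rintro ⟨t, ht, y, rfl⟩
      obtain ⟨k, hk⟩ := hU y
      exact ⟨t, ht, k, _, hsub k _ hk, congrArg (t • ·) (hΓ k _ hk)⟩

end Cone

/-! ### From local to global. -/

section Global

variable {n s : ℕ} {M : Type*} [TopologicalSpace M] [ChartedSpace (E n) M] {ψ : M → E (n + 1)}

lemma eventually_chart_iff {Q : M → Prop} {p q : M} (hq : q ∈ (extChartAt (𝓡 n) p).source) :
    (∀ᶠ y in 𝓝 (extChartAt (𝓡 n) p q), Q ((extChartAt (𝓡 n) p).symm y)) ↔ ∀ᶠ z in 𝓝 q, Q z := by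
  set e := extChartAt (𝓡 n) p
  constructor
  · intro h
    filter_upwards [(continuousAt_extChartAt' (I := 𝓡 n) hq).eventually h,
      (isOpen_extChartAt_source (I := 𝓡 n) p).mem_nhds hq] with z hz hze
    rwa [e.left_inv hze] at hz
  · intro h
    have := continuousAt_extChartAt_symm' (I := 𝓡 n) hq
    rw [ContinuousAt, e.left_inv hq] at this
    exact this.eventually h

lemma frequently_eventually_chart {Q : M → Prop} {p : M} (h : ∃ᶠ q in 𝓝 p, ∀ᶠ z in 𝓝 q, Q z) :
    ∃ᶠ x in 𝓝 (extChartAt (𝓡 n) p p), ∀ᶠ y in 𝓝 x, Q ((extChartAt (𝓡 n) p).symm y) := by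
  intro hn
  refine h ?_
  filter_upwards [(continuousAt_extChartAt (I := 𝓡 n) p).eventually hn,
    extChartAt_source_mem_nhds (I := 𝓡 n) p] with q hq hqs hQ
  exact hq ((eventually_chart_iff hqs).2 hQ)

/-- The set of points near which `Q` holds is always open; `hcl` says that it is closed. -/
lemma forall_of_eventually {X : Type*} [TopologicalSpace X] [PreconnectedSpace X] {Q : X → Prop}
    (hcl : ∀ p, (∃ᶠ q in 𝓝 p, ∀ᶠ z in 𝓝 q, Q z) → ∀ᶠ q in 𝓝 p, Q q) {p₀ : X}
    (h₀ : ∀ᶠ q in 𝓝 p₀, Q q) (p : X) : Q p := by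
  have hclopen : IsClopen {p | ∀ᶠ q in 𝓝 p, Q q} := by
    refine ⟨isClosed_of_closure_subset fun p hp => hcl p (mem_closure_iff_frequently.1 hp), ?_⟩
    exact isOpen_setOfPred_eventually_nhds
  have := hclopen.eq_univ ⟨p₀, h₀⟩
  exact (this.symm ▸ mem_univ p : p ∈ {p | ∀ᶠ q in 𝓝 p, Q q}).self_of_nhds

variable [IsManifold (𝓡 n) ∞ M] [T2Space M] [SecondCountableTopology M]

lemma exists_conic_of_tangent [Nonempty M] (hn : 2 ≤ n) (h : IsPseudoRiemannianHypersurface s ψ)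
    {φ : M → ℝ}
    (hsol : IsConformalSoliton (inducedMetric n s ψ) (tangentialPosition h) φ)
    (hN : ∀ p, normalPosition h p = 0) :
    ∃ S, range ψ ⊆ S ∧ IsConicHypersurface n S := by
  have hslice : ∀ p, ψ p ≠ 0 → ∃ γ : E (n - 1) → E (n + 1),
      (∀ y ∈ Metric.ball (0 : E (n - 1)) (1 / 2), ContDiffAt ℝ ∞ γ y ∧
        ∀ t : ℝ, 0 < t → ∀ (a : ℝ) w, a • γ y + t • fderiv ℝ γ y w = 0 → a = 0 ∧ w = 0) ∧
      ∀ᶠ q in 𝓝 p, ∃ t : ℝ, 0 ≤ t ∧ ∃ y ∈ Metric.ball (0 : E (n - 1)) (1 / 2), ψ q = t • γ y := by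
    intro p hp
    have hs := isSolitonAt_chart h hsol p
    obtain ⟨γ, h1, h2⟩ := exists_conic_slice (m := n - 1)
      (f := fun y => ψ ((extChartAt (𝓡 n) p).symm y)) (x₀ := extChartAt (𝓡 n) p p)
      (by rw [finrank_euclideanSpace_fin]; omega)
      (by filter_upwards [(isOpen_extChartAt_target (I := 𝓡 n) p).mem_nhds
            (mem_extChartAt_target p)] with y hy using contDiffAt_chart hy h.smooth)
      hs.nondegenerate.injective
      (hs.tangential.mono fun y ⟨v, hv⟩ => ⟨v, by rw [hv, hN, add_zero]⟩)
      (by rwa [extChartAt_to_inv])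
    exact ⟨γ, h1, (eventually_chart_iff (Q := fun q => ∃ t : ℝ, 0 ≤ t ∧
      ∃ y ∈ Metric.ball (0 : E (n - 1)) (1 / 2), ψ q = t • γ y) (mem_extChartAt_source p)).1 h2⟩
  choose! γ hγ hcov using hslice
  obtain ⟨T, hTs, hTc, hTcov⟩ := TopologicalSpace.countable_cover_nhdsWithin
    (s := {p | ψ p ≠ 0}) (f := fun p => {q | ∃ t : ℝ, 0 ≤ t ∧
      ∃ y ∈ Metric.ball (0 : E (n - 1)) (1 / 2), ψ q = t • γ p y})
    (fun p hp => mem_nhdsWithin_of_mem_nhds (hcov p hp))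
  -- Were `T` empty, `ψ` would vanish identically. Nonemptiness allows an enumeration by `ℕ` and
  -- supplies a ray whose apex covers the zeros of `ψ`.
  have hne : T.Nonempty := by
    by_contra hT
    rw [not_nonempty_iff_eq_empty] at hT
    subst hT
    have h0 : ψ = fun _ => 0 := by
      funext p
      by_contra hp
      simpa using hTcov hp
    obtain ⟨p⟩ := ‹Nonempty M›
    have : Nontrivial (E n) := Module.nontrivial_of_finrank_pos (R := ℝ) (by
      rw [finrank_euclideanSpace_fin]; omega)
    obtain ⟨u, hu⟩ := exists_ne (0 : E n)
    refine hu (nondegenerate_mderiv h p u fun w => ?_)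
    have : mderiv n ψ p = 0 := by rw [h0, mderiv, mfderiv_const]; rfl
    simp [this]
  obtain ⟨k, rfl⟩ := hTc.exists_eq_range hne
  refine ⟨_, ?_, isConicHypersurface_of_family hn (fun i => γ (k i)) fun i =>
    hγ _ (hTs (mem_range_self i))⟩
  rintro _ ⟨q, rfl⟩
  by_cases hq : ψ q = 0
  · exact ⟨0, le_rfl, 0, 0, by simp, by simp [hq]⟩
  · have := hTcov hq
    simp only [mem_iUnion, mem_range, exists_prop, exists_exists_eq_and] at this
    obtain ⟨i, t, ht, y, hy, h⟩ := this
    exact ⟨t, ht, i, y, hy, h⟩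

lemma isPseudoSphere_or_isPseudoHyperbolicSpace (m s : ℕ) (a : E m) {κ : ℝ} (hκ : κ ≠ 0) :
    IsPseudoHyperbolicSpace s {x | flatMetric m s (x - a) (x - a) = κ} ∨
      IsPseudoSphere s {x | flatMetric m s (x - a) (x - a) = κ} := by
  rcases lt_or_gt_of_ne hκ with h | h
  · left
    exact ⟨a, √(-κ), Real.sqrt_pos.2 (by linarith), by rw [Real.sq_sqrt (by linarith), neg_neg]⟩
  · right
    exact ⟨a, √κ, Real.sqrt_pos.2 h, by rw [Real.sq_sqrt h.le]⟩

end Global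

end ConformalSoliton

theorem theorem1p1 (n s : ℕ) (hn : 2 ≤ n) (hs : s ≤ n + 1)
    (M : Type*) [TopologicalSpace M] [T2Space M] [SecondCountableTopology M] [ConnectedSpace M]
    [ChartedSpace (EuclideanSpace ℝ (Fin n)) M] [IsManifold (𝓡 n) ∞ M]
    (ψ : M → EuclideanSpace ℝ (Fin (n + 1))) (hψ : IsPseudoRiemannianHypersurface s ψ)
    (φ : M → ℝ) (hsol : IsConformalSoliton (inducedMetric n s ψ) (tangentialPosition hψ) φ) :
    ∃ S : Set (EuclideanSpace ℝ (Fin (n + 1))), Set.range ψ ⊆ S ∧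
      (IsHyperplane S ∨ IsConicHypersurface n S ∨ IsPseudoHyperbolicSpace s S ∨
        IsPseudoSphere s S) := by
  by_cases hN : ∀ p, normalPosition hψ p = 0
  · obtain ⟨S, hS, hc⟩ := exists_conic_of_tangent hn hψ hsol hN
    exact ⟨S, hS, Or.inr (Or.inl hc)⟩
  push Not at hN
  obtain ⟨p₀, hp₀⟩ := hN
  have hloc := isSolitonAt_chart hψ hsol
  have hsymm := flatForm_comm (n + 1) s
  have hB := flatForm_nondegenerate (n + 1) s
  have hdim : Module.finrank ℝ (E (n + 1)) = Module.finrank ℝ (E n) + 1 := by simp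
  have hdimV : 2 ≤ Module.finrank ℝ (E n) := by simpa using hn
  rcases (hloc p₀).local_classification hsymm hB hdim hdimV (by rwa [extChartAt_to_inv]) with
    ⟨a, κ, hκ, h⟩ | ⟨l, hl, b, hb, h⟩
  · have hall := forall_of_eventually
      (Q := fun q => flatForm (n + 1) s (ψ q - a) (ψ q - a) = κ)
      (fun p hp => (eventually_chart_iff (mem_extChartAt_source p)).1
        ((hloc p).eventually_quadric_of_frequently hsymm hdim hdimV hκ
          (frequently_eventually_chart hp)))
      ((eventually_chart_iff (mem_extChartAt_source p₀)).1 h)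
    exact ⟨_, Set.range_subset_iff.2 hall,
      Or.inr (Or.inr (isPseudoSphere_or_isPseudoHyperbolicSpace (n + 1) s a hκ))⟩
  · have hall := forall_of_eventually (Q := fun q => l (ψ q) = b)
      (fun p hp => (eventually_chart_iff (mem_extChartAt_source p)).1
        ((hloc p).eventually_linear_eq_of_frequently hsymm hB hdim hdimV hl hb
          (frequently_eventually_chart hp)))
      ((eventually_chart_iff (mem_extChartAt_source p₀)).1 h)
    refine ⟨{x | l x = b}, Set.range_subset_iff.2 hall, Or.inl ⟨l.toLinearMap, b, ?_, rfl⟩⟩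
    intro h0
    exact hl (ContinuousLinearMap.ext fun x => LinearMap.congr_fun h0 x)
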